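/- A (semigroup) identity is a pair $u\approx v$ of words in the free semigroup $\mathfrak A^+$ over a countably infinite alphabet $\mathfrak A$; a semigroup $S$ satisfies it if $\varphi(u)=\varphi(v)$ for every homomorphism $\varphi:\mathfrak A^+\to S$. A semigroup is finitely based if there is a finite set of identities of $S$ from which all identities of $S$ can be deduced, and non-finitely based otherwise. Let $A_0=\langle a,b \mid aa=a,\ bb=b,\ ab=0\rangle$ (a presentation as a semigroup with zero $0$), and let $A_0^1$ be the monoid obtained by adjoining an identity element to $A_0$. For a set $W$ of words in the free monoid $\mathfrak A^*$, let $S(W)$ be the Rees quotient of $\mathfrak A^*$ over the ideal of all words that are not subwords (blocks of consecutive letters) of words in $W$. Let $a,t\in\mathfrak A$ be distinct letters and, for $i=1,2,\dots$, let $W_i=\{a^{i+1-d}\,t\,a^{d} : 0<d<i+1\}$ (so $W_1=\{ata\}$, $W_2=\{a^2ta,\ ata^2\}$, $W_3=\{a^3ta,\ a^2ta^2,\ ata^3\}$, \dots). Then $A_0^1$ is finitely based and, for every $i=1,2,\dots$, the monoid $S(W_i)$ is finitely based, while the direct product $A_0^1\times S(W_i)$ is non-finitely based. -/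

import Mathlib

namespace FiniteBasis

/-- The countable alphabet of variables. -/
abbrev Alphabet : Type := ℕ

/-- A (semigroup) identity `u ≈ v`: a pair of words of the free semigroup over the alphabet. -/
abbrev Identity : Type := FreeSemigroup Alphabet × FreeSemigroup Alphabet

/-- The semigroup `S` satisfies the identity `u ≈ v`: every evaluation of the variables in `S`
gives both words the same value. -/
def Satisfies (S : Type*) [Semigroup S] (e : Identity) : Prop :=
  ∀ φ : FreeSemigroup Alphabet →ₙ* S, φ e.1 = φ e.2

/-- The identity `e` can be deduced from `E`: its sides are related by the congruence on the free
semigroup generated by all pairs `Θ u, Θ v` with `u ≈ v` in `E` and `Θ` a substitution. -/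
def Deducible (E : Set Identity) (e : Identity) : Prop :=
  conGen (fun p q : FreeSemigroup Alphabet =>
    ∃ f ∈ E, ∃ Θ : FreeSemigroup Alphabet →ₙ* FreeSemigroup Alphabet,
      p = Θ f.1 ∧ q = Θ f.2) e.1 e.2

/-- `S` is finitely based: some finite set of identities of `S` implies all identities of `S`. -/
def FinitelyBased (S : Type*) [Semigroup S] : Prop :=
  ∃ E : Set Identity, E.Finite ∧ (∀ e ∈ E, Satisfies S e) ∧
    ∀ e : Identity, Satisfies S e → Deducible E e

/-- The two generators of `A₀`. -/
inductive A0Gen : Type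
  | a
  | b

/-- A generator as an element of the free semigroup with zero. -/
def A0Gen.toWord (g : A0Gen) : WithZero (FreeSemigroup A0Gen) :=
  ((FreeSemigroup.of g : FreeSemigroup A0Gen) : WithZero (FreeSemigroup A0Gen))

/-- The defining relations `aa = a`, `bb = b`, `ab = 0`. -/
inductive A0Rel : WithZero (FreeSemigroup A0Gen) → WithZero (FreeSemigroup A0Gen) → Prop
  | aa : A0Rel (A0Gen.a.toWord * A0Gen.a.toWord) A0Gen.a.toWord
  | bb : A0Rel (A0Gen.b.toWord * A0Gen.b.toWord) A0Gen.b.toWord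
  | ab : A0Rel (A0Gen.a.toWord * A0Gen.b.toWord) 0

/-- The semigroup `A₀ = ⟨a, b ∣ aa = a, bb = b, ab = 0⟩`, presented as a semigroup with zero. -/
abbrev A0 : Type := (conGen A0Rel).Quotient

/-- The monoid `A₀¹`, obtained by adjoining an identity element to `A₀`. -/
abbrev A0One : Type := WithOne A0

/-- `w` is a subword (a block of consecutive letters) of a word in `W`. -/
def IsSubwordOf (W : Set (FreeMonoid Alphabet)) (w : FreeMonoid Alphabet) : Prop :=
  ∃ w' ∈ W, ∃ p q : FreeMonoid Alphabet, w' = p * w * q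

theorem IsSubwordOf.left {W : Set (FreeMonoid Alphabet)} {u v : FreeMonoid Alphabet}
    (h : IsSubwordOf W (u * v)) : IsSubwordOf W u := by
  obtain ⟨w', hw', p, q, rfl⟩ := h
  exact ⟨_, hw', p, v * q, by simp only [mul_assoc]⟩

theorem IsSubwordOf.right {W : Set (FreeMonoid Alphabet)} {u v : FreeMonoid Alphabet}
    (h : IsSubwordOf W (u * v)) : IsSubwordOf W v := by
  obtain ⟨w', hw', p, q, rfl⟩ := h
  exact ⟨_, hw', p * u, q, by simp only [mul_assoc]⟩

/-- The Rees congruence of the ideal of all words that are not subwords of words in `W`. -/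
def reesCon (W : Set (FreeMonoid Alphabet)) : Con (FreeMonoid Alphabet) where
  r u v := u = v ∨ (¬ IsSubwordOf W u ∧ ¬ IsSubwordOf W v)
  iseqv :=
    { refl := fun _ => Or.inl rfl
      symm := by
        rintro u v (rfl | ⟨h, h'⟩)
        · exact Or.inl rfl
        · exact Or.inr ⟨h', h⟩
      trans := by
        rintro u v w (rfl | ⟨h, h'⟩) (rfl | ⟨k, k'⟩)
        · exact Or.inl rfl
        · exact Or.inr ⟨k, k'⟩
        · exact Or.inr ⟨h, h'⟩
        · exact Or.inr ⟨h, k'⟩ }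
  mul' := by
    rintro u v x y (rfl | ⟨h, h'⟩) (rfl | ⟨k, k'⟩)
    · exact Or.inl rfl
    · exact Or.inr ⟨fun s => k s.right, fun s => k' s.right⟩
    · exact Or.inr ⟨fun s => h s.left, fun s => h' s.left⟩
    · exact Or.inr ⟨fun s => h s.left, fun s => h' s.left⟩

/-- The monoid `S(W)`: the Rees quotient of the free monoid over the ideal of all words that are
not subwords of words in `W`. -/
abbrev SMonoid (W : Set (FreeMonoid Alphabet)) : Type := (reesCon W).Quotient

/-- `W_i = {a^(i+1-d) t a^d : 0 < d < i + 1}`. -/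
def wordSet (a t : Alphabet) (i : ℕ) : Set (FreeMonoid Alphabet) :=
  {w | ∃ d : ℕ, 0 < d ∧ d < i + 1 ∧
    w = FreeMonoid.of a ^ (i + 1 - d) * FreeMonoid.of t * FreeMonoid.of a ^ d}

end FiniteBasis

/-!
`A₀¹` is isomorphic to the monoid of order-preserving extensive maps of a three-element chain, so
it satisfies `u ≈ v` exactly when `u` and `v` have the same scattered subwords of length at most
two. Two such words are aligned letter by letter from the left, each step inserting or deleting one
letter by means of an identity of bounded length.

A substitution that does not erase `x` sends `u` to zero in `S(W_i)` whenever `x` occurs at least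
`i + 2` times in `u`, or `i + 1` times without a letter of multiplicity one between two of its
occurrences; then all occurrences of `x` can be collected at the front as `x^(i+1)`. When there is
no such `x`, an identity `u ≈ v` of `S(W_i)` preserves multiplicities and the positions of all
letters relative to the letters of multiplicity one, and it suffices to commute adjacent letters
that are both repeated.

For the direct product, consider
`u = (z₀ ⋯ zₙ₋₁) s (x^i y₀ z₀ ⋯ yₙ₋₁ zₙ₋₁ x) s' (y₀ ⋯ yₙ₋₁)`.
Both factors satisfy `u ≈ v`, where `v` is `u` with `x^(i+1)` in place of `x^i`. An identity of the
product that changes the number of occurrences of `x` can be applied to a word equivalent to `u`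
only if repeated letters of its left-hand side cover the whole stretch between the first and the
last `x`. Their images cannot contain `s`, and each of them contains at most one of the letters
`zⱼ`: `zⱼ` occurs only once to the right of `s`, and `yₖ` occurs before `zⱼ` exactly when `k ≤ j`.
Therefore such an identity has about `n` letters, and no finite set of identities suffices for all
`n`.
-/

namespace FiniteBasis

open List

section Words

/-- The word, as a list of letters, represented by an element of the free semigroup. -/
def toWord (p : FreeSemigroup ℕ) : List ℕ := (FreeSemigroup.toFreeMonoid p).toList

theorem toWord_of (x : ℕ) : toWord (FreeSemigroup.of x) = [x] := rfl

theorem toWord_mul (p q : FreeSemigroup ℕ) : toWord (p * q) = toWord p ++ toWord q := by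
  simp only [toWord, map_mul, FreeMonoid.toList_mul]

theorem toWord_ne_nil (p : FreeSemigroup ℕ) : toWord p ≠ [] :=
  FreeSemigroup.toFreeMonoid_ne_one p

theorem toWord_injective : Function.Injective toWord :=
  FreeMonoid.toList.injective.comp FreeSemigroup.toFreeMonoid_injective

theorem exists_toWord_eq {l : List ℕ} (h : l ≠ []) : ∃ p, toWord p = l :=
  (FreeSemigroup.eq_one_or_toFreeMonoid (FreeMonoid.ofList l)).resolve_left h

theorem map_eq_prod_map_toWord {S : Type*} [Monoid S] (φ : FreeSemigroup ℕ →ₙ* S)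
    (p : FreeSemigroup ℕ) :
    φ p = ((toWord p).map fun x => φ (FreeSemigroup.of x)).prod := by
  induction p using FreeSemigroup.recOnMul with
  | ih1 x => simp [toWord_of]
  | ih2 x y hx hy => rw [map_mul, toWord_mul, map_append, prod_append, hx, hy]

theorem toWord_map (Θ : FreeSemigroup ℕ →ₙ* FreeSemigroup ℕ) (p : FreeSemigroup ℕ) :
    toWord (Θ p) = (toWord p).flatMap fun x => toWord (Θ (FreeSemigroup.of x)) := by
  induction p using FreeSemigroup.recOnMul with
  | ih1 x => simp [toWord_of]
  | ih2 x y hx hy => rw [map_mul, toWord_mul, toWord_mul, flatMap_append, hx, hy]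

theorem exists_hom_toWord_eq_flatMap (θ : ℕ → List ℕ) :
    ∃ Θ : FreeSemigroup ℕ →ₙ* FreeSemigroup ℕ, ∀ p, (∀ x ∈ toWord p, θ x ≠ []) →
      toWord (Θ p) = (toWord p).flatMap θ := by
  have hex : ∀ x, ∃ r, θ x ≠ [] → toWord r = θ x := fun x => by
    by_cases hx : θ x = []
    · exact ⟨FreeSemigroup.of x, fun h => absurd hx h⟩
    · exact (exists_toWord_eq hx).imp fun r hr _ => hr
  choose r hr using hex
  refine ⟨FreeSemigroup.lift r, fun p hp => ?_⟩
  rw [toWord_map]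
  exact flatMap_congr fun x hx => by rw [FreeSemigroup.lift_of, hr x (hp x hx)]

end Words

section Sat

/-- The word identity `u ≈ v` holds in the monoid `S`: every evaluation of the letters gives `u`
and `v` the same value. In contrast to `Satisfies`, the words may be empty and the alphabet is
arbitrary. -/
def Sat {α : Type*} (S : Type*) [Monoid S] (u v : List α) : Prop :=
  ∀ φ : α → S, (u.map φ).prod = (v.map φ).prod

theorem satisfies_iff {S : Type*} [Monoid S] (e : Identity) :
    Satisfies S e ↔ Sat S (toWord e.1) (toWord e.2) := by
  refine ⟨fun h φ => ?_, fun h φ => ?_⟩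
  · simpa only [map_eq_prod_map_toWord, FreeSemigroup.lift_of] using h (FreeSemigroup.lift φ)
  · rw [map_eq_prod_map_toWord, map_eq_prod_map_toWord]
    exact h _

namespace Sat

variable {α β S T : Type*} [Monoid S] [Monoid T] {u v w : List α}

theorem refl (u : List α) : Sat S u u := fun _ => rfl

theorem symm (h : Sat S u v) : Sat S v u := fun φ => (h φ).symm

theorem trans (h : Sat S u v) (k : Sat S v w) : Sat S u w := fun φ => (h φ).trans (k φ)

theorem context (h : Sat S u v) (p q : List α) : Sat S (p ++ u ++ q) (p ++ v ++ q) := fun φ => by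
  simp only [map_append, prod_append, h φ]

theorem subst (h : Sat S u v) (θ : α → List β) : Sat S (u.flatMap θ) (v.flatMap θ) := fun φ => by
  simpa only [flatMap_def, map_flatten, prod_flatten, map_map, Function.comp_def]
    using h fun x => ((θ x).map φ).prod

theorem filter (h : Sat S u v) (P : α → Bool) : Sat S (u.filter P) (v.filter P) := by
  simpa only [← filter_flatMap, flatMap_singleton'] using h.subst fun x => [x].filter P

theorem apply_hom_eq (h : Sat T u v) (f : S →* T) (φ : α → S) :
    f (u.map φ).prod = f (v.map φ).prod := by
  simpa only [map_list_prod, map_map] using h (f ∘ φ)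

theorem of_injective (f : S →* T) (hf : Function.Injective f) (h : Sat T u v) : Sat S u v :=
  fun φ => hf (h.apply_hom_eq f φ)

end Sat

variable {α S T : Type*} [Monoid S] [Monoid T] {u v : List α}

theorem sat_congr (e : S ≃* T) : Sat S u v ↔ Sat T u v :=
  ⟨Sat.of_injective e.symm.toMonoidHom e.symm.injective,
    Sat.of_injective e.toMonoidHom e.injective⟩

theorem sat_prod_iff : Sat (S × T) u v ↔ Sat S u v ∧ Sat T u v := by
  refine ⟨fun h => ⟨h.of_injective (MonoidHom.inl S T) fun _ _ k => congrArg Prod.fst k,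
    h.of_injective (MonoidHom.inr S T) fun _ _ k => congrArg Prod.snd k⟩, fun h φ => ?_⟩
  exact Prod.ext (h.1.apply_hom_eq (MonoidHom.fst S T) φ) (h.2.apply_hom_eq (MonoidHom.snd S T) φ)

end Sat

section Derives

/-- `u ≈ v` can be deduced from `E`, where the empty word may only be rewritten into itself. -/
def Derives (E : Set Identity) (u v : List ℕ) : Prop :=
  (u = [] ∧ v = []) ∨ ∃ p q, toWord p = u ∧ toWord q = v ∧ Deducible E (p, q)

theorem derives_toWord_iff {E : Set Identity} {p q : FreeSemigroup ℕ} :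
    Derives E (toWord p) (toWord q) ↔ Deducible E (p, q) := by
  refine ⟨?_, fun h => Or.inr ⟨p, q, rfl, rfl, h⟩⟩
  rintro (⟨hp, -⟩ | ⟨p', q', hp, hq, h⟩)
  · exact absurd hp (toWord_ne_nil p)
  · rwa [← toWord_injective hp, ← toWord_injective hq]

namespace Derives

variable {E : Set Identity} {u v w u' v' : List ℕ}

theorem refl (u : List ℕ) : Derives E u u := by
  by_cases h : u = []
  · exact Or.inl ⟨h, h⟩
  · obtain ⟨p, rfl⟩ := exists_toWord_eq h
    exact derives_toWord_iff.2 (Con.refl _ _)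

theorem of_eq (h : u = v) : Derives E u v := h ▸ refl u

theorem symm (h : Derives E u v) : Derives E v u := by
  rcases h with ⟨rfl, rfl⟩ | ⟨p, q, rfl, rfl, h⟩
  · exact refl _
  · exact derives_toWord_iff.2 (Con.symm _ h)

theorem trans (h : Derives E u v) (k : Derives E v w) : Derives E u w := by
  rcases h with ⟨rfl, rfl⟩ | ⟨p, q, rfl, rfl, h⟩
  · exact k
  · rcases k with ⟨k, -⟩ | ⟨p', q', hp, rfl, k⟩
    · exact absurd k (toWord_ne_nil q)
    · obtain rfl := toWord_injective hp
      exact derives_toWord_iff.2 (Con.trans _ h k)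

theorem append (h : Derives E u v) (k : Derives E u' v') : Derives E (u ++ u') (v ++ v') := by
  rcases h with ⟨rfl, rfl⟩ | ⟨p, q, rfl, rfl, h⟩
  · exact k
  · rcases k with ⟨rfl, rfl⟩ | ⟨p', q', rfl, rfl, k⟩
    · simpa only [append_nil] using derives_toWord_iff.2 h
    · simpa only [toWord_mul] using derives_toWord_iff.2 (Con.mul _ h k)

theorem context (h : Derives E u v) (p q : List ℕ) : Derives E (p ++ u ++ q) (p ++ v ++ q) :=
  ((refl p).append h).append (refl q)

end Derives

end Derives

section BoundedIdentities

/-- The length of `u` is at most `N`, and all its letters are below `N`. -/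
def Bounded (N : ℕ) (u : List ℕ) : Prop := u.length ≤ N ∧ ∀ x ∈ u, x < N

instance (N : ℕ) (u : List ℕ) : Decidable (Bounded N u) := inferInstanceAs (Decidable (_ ∧ _))

theorem Bounded.mono {M N : ℕ} {u : List ℕ} (h : Bounded M u) (hMN : M ≤ N) : Bounded N u :=
  ⟨h.1.trans hMN, fun x hx => (h.2 x hx).trans_le hMN⟩

theorem Bounded.filter {N : ℕ} {u : List ℕ} (h : Bounded N u) (P : ℕ → Bool) :
    Bounded N (u.filter P) :=
  ⟨(length_filter_le _ _).trans h.1, fun x hx => h.2 x (mem_of_mem_filter hx)⟩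

theorem Bounded.perm {N : ℕ} {u v : List ℕ} (h : Bounded N u) (huv : u ~ v) : Bounded N v :=
  ⟨huv.length_eq ▸ h.1, fun x hx => h.2 x (huv.mem_iff.2 hx)⟩

theorem finite_setOf_bounded (N : ℕ) : {u | Bounded N u}.Finite := by
  refine ((finite_length_le (Fin N) N).image (List.map Fin.val)).subset ?_
  rintro u ⟨hlen, hlt⟩
  exact ⟨u.pmap Fin.mk hlt, by simpa using hlen, by simp [map_pmap]⟩

/-- The identities of `S` whose two sides are `N`-bounded: a finite set, which for suitable `N`
serves as a basis. -/
def boundedIdentities (S : Type*) [Monoid S] (N : ℕ) : Set Identity :=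
  {e | Satisfies S e ∧ Bounded N (toWord e.1) ∧ Bounded N (toWord e.2)}

theorem finite_boundedIdentities (S : Type*) [Monoid S] (N : ℕ) :
    (boundedIdentities S N).Finite := by
  have h := (finite_setOf_bounded N).preimage toWord_injective.injOn
  exact (h.prod h).subset fun e he => he.2

variable {S : Type*} [Monoid S] {N : ℕ}

theorem finitelyBased_of_derives (h : ∀ u v, Sat S u v → Derives (boundedIdentities S N) u v) :
    FinitelyBased S :=
  ⟨_, finite_boundedIdentities S N, fun _ he => he.1, fun e he =>
    derives_toWord_iff.1 (h _ _ ((satisfies_iff e).1 he))⟩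

theorem flatMap_filter_of_forall {α β : Type*} {θ : α → List β} {P : α → Bool}
    (h : ∀ x, P x = false → θ x = []) (u : List α) : (u.filter P).flatMap θ = u.flatMap θ := by
  induction u with
  | nil => rfl
  | cons x u ih =>
    cases hx : P x with
    | false => rw [filter_cons_of_neg (by simp [hx]), ih, flatMap_cons, h x hx, nil_append]
    | true => rw [filter_cons_of_pos hx, flatMap_cons, flatMap_cons, ih]

theorem derives_flatMap_of_ne_nil {u v : List ℕ} (h : Sat S u v) (hu : Bounded N u)
    (hv : Bounded N v) (hc : ∀ x, x ∈ u ↔ x ∈ v) {θ : ℕ → List ℕ} (hθ : ∀ x ∈ u, θ x ≠ []) :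
    Derives (boundedIdentities S N) (u.flatMap θ) (v.flatMap θ) := by
  by_cases hnil : u = []
  · have hnil' : v = [] := eq_nil_iff_forall_not_mem.2 fun x hx => by simpa [hnil] using (hc x).2 hx
    exact Derives.of_eq (by rw [hnil, hnil'])
  have hnil' : v ≠ [] := by
    rintro rfl
    exact hnil (eq_nil_iff_forall_not_mem.2 fun x hx => by simpa using (hc x).1 hx)
  obtain ⟨p, rfl⟩ := exists_toWord_eq hnil
  obtain ⟨q, rfl⟩ := exists_toWord_eq hnil'
  obtain ⟨Θ, hΘ⟩ := exists_hom_toWord_eq_flatMap θ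
  rw [← hΘ p hθ, ← hΘ q fun x hx => hθ x ((hc x).2 hx)]
  exact derives_toWord_iff.2 (ConGen.Rel.of _ _
    ⟨(p, q), ⟨(satisfies_iff (p, q)).2 h, hu, hv⟩, Θ, rfl, rfl⟩)

theorem derives_flatMap {u v : List ℕ} (h : Sat S u v) (hu : Bounded N u) (hv : Bounded N v)
    (hc : ∀ x, x ∈ u ↔ x ∈ v) (θ : ℕ → List ℕ) :
    Derives (boundedIdentities S N) (u.flatMap θ) (v.flatMap θ) := by
  have hθ : ∀ x, decide (θ x ≠ []) = false → θ x = [] := fun x hx => by simpa using hx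
  rw [← flatMap_filter_of_forall hθ u, ← flatMap_filter_of_forall hθ v]
  exact derives_flatMap_of_ne_nil (h.filter _) (hu.filter _) (hv.filter _)
    (fun x => by simp only [mem_filter, hc]) fun x hx => by simpa using (mem_filter.1 hx).2

theorem derives_swap_of_mem_left (hN : 6 ≤ N)
    (h : Sat S [0, 2, 1, 3, 0, 1] [0, 2, 1, 3, 1, 0]) {p q : List ℕ} {x y : ℕ}
    (hx : x ∈ p) (hy : y ∈ p) :
    Derives (boundedIdentities S N) (p ++ x :: y :: q) (p ++ y :: x :: q) := by
  have swap_of_order : ∀ (p₁ p₂ p₃ : List ℕ) (x y : ℕ), Derives (boundedIdentities S N)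
      (p₁ ++ x :: p₂ ++ y :: p₃ ++ x :: y :: q) (p₁ ++ x :: p₂ ++ y :: p₃ ++ y :: x :: q) :=
    fun p₁ p₂ p₃ x y => by
      simpa using (derives_flatMap h (Bounded.mono (by decide) hN) (Bounded.mono (by decide) hN)
        (fun _ => Perm.mem_iff (by decide)) fun k => [[x], [y], p₂, p₃].getD k []).context p₁ q
  obtain ⟨p₁, p₂, rfl⟩ := append_of_mem hx
  rcases mem_append.1 hy with hy | hy
  · obtain ⟨p₀, p₁, rfl⟩ := append_of_mem hy
    exact (by simpa using swap_of_order p₀ p₁ p₂ y x : Derives _ _ _).symm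
  · rcases mem_cons.1 hy with rfl | hy
    · exact Derives.refl _
    · obtain ⟨p₂, p₃, rfl⟩ := append_of_mem hy
      simpa using swap_of_order p₁ p₂ p₃ x y

theorem derives_swap_of_mem_right (hN : 6 ≤ N)
    (h : Sat S [0, 1, 2, 0, 3, 1] [1, 0, 2, 0, 3, 1]) {p q : List ℕ} {x y : ℕ}
    (hx : x ∈ q) (hy : y ∈ q) :
    Derives (boundedIdentities S N) (p ++ x :: y :: q) (p ++ y :: x :: q) := by
  have swap_of_order : ∀ (q₁ q₂ q₃ : List ℕ) (x y : ℕ), Derives (boundedIdentities S N)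
      (p ++ x :: y :: (q₁ ++ x :: q₂ ++ y :: q₃)) (p ++ y :: x :: (q₁ ++ x :: q₂ ++ y :: q₃)) :=
    fun q₁ q₂ q₃ x y => by
      simpa using (derives_flatMap h (Bounded.mono (by decide) hN) (Bounded.mono (by decide) hN)
        (fun _ => Perm.mem_iff (by decide)) fun k => [[x], [y], q₁, q₂].getD k []).context p q₃
  obtain ⟨q₁, q₂, rfl⟩ := append_of_mem hx
  rcases mem_append.1 hy with hy | hy
  · obtain ⟨q₀, q₁, rfl⟩ := append_of_mem hy
    exact (by simpa using swap_of_order q₀ q₁ q₂ y x : Derives _ _ _).symm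
  · rcases mem_cons.1 hy with rfl | hy
    · exact Derives.refl _
    · obtain ⟨q₂, q₃, rfl⟩ := append_of_mem hy
      simpa using swap_of_order q₁ q₂ q₃ x y

end BoundedIdentities

section SubwordEquiv

variable {α : Type*} {n : ℕ} {u v w : List α}

/-- `u` and `v` have the same scattered subwords of length at most `n`. -/
def SubwordEquiv (n : ℕ) (u v : List α) : Prop :=
  ∀ l : List α, l.length ≤ n → (l <+ u ↔ l <+ v)

theorem SubwordEquiv.symm (h : SubwordEquiv n u v) : SubwordEquiv n v u :=
  fun l hl => (h l hl).symm

theorem SubwordEquiv.trans (h : SubwordEquiv n u v) (k : SubwordEquiv n v w) :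
    SubwordEquiv n u w :=
  fun l hl => (h l hl).trans (k l hl)

theorem SubwordEquiv.of_sublist (h : SubwordEquiv n u w) (huv : u <+ v) (hvw : v <+ w) :
    SubwordEquiv n u v :=
  fun l hl => ⟨fun k => k.trans huv, fun k => (h l hl).2 (k.trans hvw)⟩

theorem subwordEquiv_iff_forall_mem_sublists' : SubwordEquiv n u v ↔
    (∀ l ∈ u.sublists', l.length ≤ n → l <+ v) ∧ ∀ l ∈ v.sublists', l.length ≤ n → l <+ u := by
  simp only [mem_sublists']
  exact ⟨fun h => ⟨fun l hl hn => (h l hn).1 hl, fun l hl hn => (h l hn).2 hl⟩,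
    fun h l hn => ⟨fun hl => h.1 l hl hn, fun hl => h.2 l hl hn⟩⟩

instance [DecidableEq α] : Decidable (SubwordEquiv n u v) :=
  decidable_of_iff' _ subwordEquiv_iff_forall_mem_sublists'

theorem subwordEquiv_two_iff : SubwordEquiv 2 u v ↔
    (∀ x, x ∈ u ↔ x ∈ v) ∧ ∀ x y, [x, y] <+ u ↔ [x, y] <+ v := by
  refine ⟨fun h => ⟨fun x => ?_, fun x y => h [x, y] le_rfl⟩, fun h l hl => ?_⟩
  · simpa only [singleton_sublist] using h [x] one_le_two
  · match l, hl with
    | [], _ => simp only [nil_sublist]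
    | [x], _ => simpa only [singleton_sublist] using h.1 x
    | [x, y], _ => exact h.2 x y

end SubwordEquiv

section Catalan

/-- The Catalan monoid of order-preserving extensive self-maps of a chain with `n + 1` elements,
composed from right to left. -/
def Catalan (n : ℕ) : Submonoid (Fin (n + 1) →o Fin (n + 1)) where
  carrier := {f | ∀ i, i ≤ f i}
  mul_mem' hf hg i := (hg i).trans (hf _)
  one_mem' _ := le_rfl

namespace Catalan

variable {n : ℕ}

instance : DecidableEq (Catalan n) := fun f g =>
  decidable_of_iff (∀ i, f.1 i = g.1 i)
    ⟨fun h => Subtype.ext (OrderHom.ext _ _ (funext h)), fun h _ => by rw [h]⟩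

/-- The constant map onto the largest element of the chain; it is the zero of `Catalan n`. -/
def top (n : ℕ) : Catalan n := ⟨OrderHom.const _ (Fin.last n), Fin.le_last⟩

theorem top_mul (f : Catalan n) : top n * f = top n := rfl

theorem mul_top (f : Catalan n) : f * top n = top n :=
  Subtype.ext <| OrderHom.ext _ _ <| funext fun _ => le_antisymm (Fin.le_last _) (f.2 _)

variable {α : Type*} (φ : α → Catalan n)

theorem prod_map_cons_apply (c : α) (w : List α) (i : Fin (n + 1)) :
    ((c :: w).map φ).prod.1 i = (φ c).1 ((w.map φ).prod.1 i) := by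
  rw [map_cons, prod_cons]
  rfl

theorem prod_map_apply_le_of_sublist {w' w : List α} (h : w' <+ w) (i : Fin (n + 1)) :
    (w'.map φ).prod.1 i ≤ (w.map φ).prod.1 i := by
  induction h with
  | slnil => rfl
  | cons c _ ih =>
    rw [prod_map_cons_apply]
    exact ih.trans ((φ c).2 _)
  | cons_cons c _ ih =>
    rw [prod_map_cons_apply, prod_map_cons_apply]
    exact (φ c).1.monotone ih

theorem exists_short_sublist_prod_map_apply_eq (w : List α) (i : Fin (n + 1)) :
    ∃ w', w' <+ w ∧ (w'.map φ).prod.1 i = (w.map φ).prod.1 i ∧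
      w'.length + i.val ≤ ((w.map φ).prod.1 i).val := by
  induction w with
  | nil => exact ⟨[], Sublist.slnil, rfl, by simp⟩
  | cons c w ih =>
    obtain ⟨w', hw', heq, hlen⟩ := ih
    simp only [prod_map_cons_apply]
    by_cases hc : (φ c).1 ((w.map φ).prod.1 i) = (w.map φ).prod.1 i
    · exact ⟨w', hw'.cons c, by rw [heq, hc], by rwa [hc]⟩
    · refine ⟨c :: w', hw'.cons_cons c, by rw [prod_map_cons_apply, heq], ?_⟩
      have hlt := Fin.lt_def.1 (lt_of_le_of_ne ((φ c).2 _) (Ne.symm hc))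
      rw [length_cons]
      omega

/-- The evaluation detecting the scattered subword `l`: applied to `0`, the value of `w` counts how
many of the last letters of `l` are found when `w` is scanned greedily from the right. -/
def scan [DecidableEq α] (l : List α) (hl : l.length ≤ n) (c : α) : Catalan n :=
  ⟨⟨fun i => ⟨if l.reverse[i.val]? = some c then i + 1 else i, by
      split_ifs with h
      · have := (List.getElem?_eq_some_iff.1 h).1
        rw [length_reverse] at this
        omega
      · exact i.isLt⟩,
    fun i j hij => by
      rcases hij.eq_or_lt with rfl | hij
      · exact le_rfl
      · rw [Fin.lt_def] at hij
        rw [Fin.mk_le_mk]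
        split_ifs <;> omega⟩,
    fun i => Fin.le_def.2 <| by
      change i.val ≤ ite _ _ _
      split_ifs <;> omega⟩

variable [DecidableEq α] {l : List α} (hl : l.length ≤ n)

theorem scan_apply (c : α) (i : Fin (n + 1)) : ((scan l hl c).1 i).val =
    if l.reverse[i.val]? = some c then i.val + 1 else i.val :=
  rfl

theorem reverse_take_scan_sublist (w : List α) :
    (l.reverse.take ((w.map (scan l hl)).prod.1 0).val).reverse <+ w := by
  induction w with
  | nil => simp
  | cons c w ih =>
    rw [prod_map_cons_apply, scan_apply]
    split_ifs with hc
    · rw [take_add_one, hc, Option.toList_some, reverse_append, reverse_singleton,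
        singleton_append]
      exact ih.cons_cons c
    · exact ih.cons c

theorem scan_suffix {s : List α} (hs : s <:+ l) :
    ((s.map (scan l hl)).prod.1 0).val = s.length := by
  induction s with
  | nil => rfl
  | cons c s ih =>
    rw [prod_map_cons_apply, scan_apply, ih ((suffix_cons c s).trans hs), length_cons]
    obtain ⟨p, rfl⟩ := hs
    simp

theorem length_le_scan_iff (w : List α) :
    l.length ≤ ((w.map (scan l hl)).prod.1 0).val ↔ l <+ w := by
  refine ⟨fun h => ?_, fun h => ?_⟩
  · have := reverse_take_scan_sublist hl w
    rwa [take_of_length_le (by rwa [length_reverse]), reverse_reverse] at this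
  · rw [← scan_suffix hl (suffix_refl l)]
    exact prod_map_apply_le_of_sublist _ h 0

end Catalan

theorem sat_catalan_iff {α : Type*} {n : ℕ} {u v : List α} :
    Sat (Catalan n) u v ↔ SubwordEquiv n u v := by
  classical
  refine ⟨fun h l hl => ?_, fun h φ => ?_⟩
  · rw [← Catalan.length_le_scan_iff hl, ← Catalan.length_le_scan_iff hl, h]
  · have le_of_subwordEquiv : ∀ {u v : List α}, SubwordEquiv n u v → ∀ i,
        (u.map φ).prod.1 i ≤ (v.map φ).prod.1 i := by
      intro u v h i
      obtain ⟨w, hwu, heq, hlen⟩ := Catalan.exists_short_sublist_prod_map_apply_eq φ u i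
      rw [← heq]
      exact Catalan.prod_map_apply_le_of_sublist φ ((h w (by omega)).1 hwu) i
    exact Subtype.ext <| OrderHom.ext _ _ <| funext fun i =>
      le_antisymm (le_of_subwordEquiv h i) (le_of_subwordEquiv h.symm i)

end Catalan

section A0One

/-- The images of the generators of `A₀` in the Catalan monoid of the three-element chain. -/
def A0Gen.toCatalan : A0Gen → Catalan 2
  | A0Gen.a => ⟨⟨![0, 2, 2], fun i j => by decide +revert⟩, fun i => by decide +revert⟩
  | A0Gen.b => ⟨⟨![1, 1, 2], fun i j => by decide +revert⟩, fun i => by decide +revert⟩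

/-- The extension of `A0Gen.toCatalan` to the free semigroup with zero. -/
def freeToCatalan : WithZero (FreeSemigroup A0Gen) →ₙ* Catalan 2 where
  toFun := WithZero.recZeroCoe (Catalan.top 2) (FreeSemigroup.lift A0Gen.toCatalan)
  map_mul' x y := by
    induction x using WithZero.recZeroCoe with
    | zero => exact (Catalan.top_mul _).symm
    | coe x =>
      induction y using WithZero.recZeroCoe with
      | zero => exact (Catalan.mul_top _).symm
      | coe y => exact map_mul (FreeSemigroup.lift A0Gen.toCatalan) x y

theorem conGen_A0Rel_le : conGen A0Rel ≤ Con.ker freeToCatalan := by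
  refine Con.conGen_le.2 fun x y h => ?_
  cases h with
  | aa => exact (by decide : A0Gen.a.toCatalan * A0Gen.a.toCatalan = A0Gen.a.toCatalan)
  | bb => exact (by decide : A0Gen.b.toCatalan * A0Gen.b.toCatalan = A0Gen.b.toCatalan)
  | ab => exact (by decide : A0Gen.a.toCatalan * A0Gen.b.toCatalan = Catalan.top 2)

namespace A0

/-- The homomorphism from `A₀` to the Catalan monoid induced by `A0Gen.toCatalan`. -/
def toCatalan : A0 →ₙ* Catalan 2 where
  toFun q := Con.liftOn q freeToCatalan fun _ _ h => conGen_A0Rel_le h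
  map_mul' x y := by
    induction x, y using Con.induction_on₂ with
    | H x y => exact map_mul freeToCatalan x y

/-- The element of `A₀` represented by a generator. -/
def gen (g : A0Gen) : A0 := (g.toWord : A0)

/-- The zero of `A₀`. -/
def zero : A0 := ((0 : WithZero (FreeSemigroup A0Gen)) : A0)

theorem a_mul_a : gen .a * gen .a = gen .a := (Con.eq _).2 (ConGen.Rel.of _ _ A0Rel.aa)

theorem b_mul_b : gen .b * gen .b = gen .b := (Con.eq _).2 (ConGen.Rel.of _ _ A0Rel.bb)

theorem a_mul_b : gen .a * gen .b = zero := (Con.eq _).2 (ConGen.Rel.of _ _ A0Rel.ab)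

theorem zero_mul (x : A0) : zero * x = zero := by
  induction x using Con.induction_on with
  | H x => exact congrArg Con.toQuotient (MulZeroClass.zero_mul x)

theorem mul_zero (x : A0) : x * zero = zero := by
  induction x using Con.induction_on with
  | H x => exact congrArg Con.toQuotient (MulZeroClass.mul_zero x)

theorem induction_on {P : A0 → Prop} (x : A0) (zero : P zero) (gen : ∀ g, P (gen g))
    (gen_mul : ∀ g y, P y → P (A0.gen g * y)) : P x := by
  induction x using Con.induction_on with
  | H x =>
    induction x using WithZero.recZeroCoe with
    | zero => exact zero
    | coe x =>
      induction x using FreeSemigroup.recOnMul with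
      | ih1 g => exact gen g
      | ih2 g y _ hy => exact gen_mul g _ hy

theorem eq_zero_or_eq (x : A0) :
    x = zero ∨ x = gen .a ∨ x = gen .b ∨ x = gen .b * gen .a := by
  induction x using A0.induction_on with
  | zero => exact Or.inl rfl
  | gen g => cases g <;> simp only [true_or, or_true]
  | gen_mul g y hy =>
    rcases hy with rfl | rfl | rfl | rfl <;> cases g <;>
      simp only [mul_zero, a_mul_a, b_mul_b, a_mul_b, ← mul_assoc, zero_mul, true_or, or_true]

end A0

namespace A0One

/-- The homomorphism from `A₀¹` to the Catalan monoid induced by `A0Gen.toCatalan`. -/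
def toCatalan : A0One →* Catalan 2 := WithOne.lift A0.toCatalan

theorem eq_one_or_eq (x : A0One) : x = 1 ∨ x = A0.zero ∨ x = A0.gen .a ∨ x = A0.gen .b ∨
    x = (A0.gen .b * A0.gen .a : A0) := by
  induction x using WithOne.recOneCoe with
  | one => exact Or.inl rfl
  | coe x => rcases A0.eq_zero_or_eq x with rfl | rfl | rfl | rfl <;> simp only [true_or, or_true]

theorem toCatalan_injective : Function.Injective toCatalan := by
  intro x y h
  rcases eq_one_or_eq x with rfl | rfl | rfl | rfl | rfl <;>
    rcases eq_one_or_eq y with rfl | rfl | rfl | rfl | rfl <;>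
    first | rfl | exact absurd h (by decide)

theorem toCatalan_surjective : Function.Surjective toCatalan := by
  have classification : ∀ g : Fin 3 → Fin 3, (∀ i j, i ≤ j → g i ≤ g j) → (∀ i, i ≤ g i) →
      g = (toCatalan 1).1 ∨ g = (toCatalan A0.zero).1 ∨ g = (toCatalan (A0.gen .a)).1 ∨
        g = (toCatalan (A0.gen .b)).1 ∨ g = (toCatalan (A0.gen .b * A0.gen .a : A0)).1 := by
    decide
  intro f
  rcases classification f.1 (fun i j h => f.1.monotone h) f.2 with h | h | h | h | h <;>
    exact ⟨_, (Subtype.ext (OrderHom.ext _ _ h)).symm⟩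

end A0One

theorem sat_A0One_iff {α : Type*} {u v : List α} : Sat A0One u v ↔ SubwordEquiv 2 u v :=
  (sat_congr (MulEquiv.ofBijective A0One.toCatalan
    ⟨A0One.toCatalan_injective, A0One.toCatalan_surjective⟩)).trans sat_catalan_iff

end A0One

section FiniteBasisA0One

theorem pair_sublist_cons_iff {α : Type*} {x y c : α} {l : List α} :
    [x, y] <+ c :: l ↔ (x = c ∧ y ∈ l) ∨ [x, y] <+ l := by
  rw [sublist_cons_iff, or_comm]
  simp

theorem pair_sublist_append_iff {α : Type*} {x y : α} {p q : List α} :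
    [x, y] <+ p ++ q ↔ [x, y] <+ p ∨ (x ∈ p ∧ y ∈ q) ∨ [x, y] <+ q := by
  induction p with
  | nil => simp
  | cons c p ih =>
    rw [cons_append, pair_sublist_cons_iff, pair_sublist_cons_iff, ih, mem_append, mem_cons]
    tauto

theorem mem_left_of_pair_sublist {α : Type*} {x y : α} {l : List α} (h : [x, y] <+ l) : x ∈ l :=
  h.subset (by simp)

theorem mem_right_of_pair_sublist {α : Type*} {x y : α} {l : List α} (h : [x, y] <+ l) : y ∈ l :=
  h.subset (by simp)

theorem exists_append_cons_not_mem_right {α : Type*} {x : α} {p : List α} (h : x ∈ p) :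
    ∃ p₁ p₂, p = p₁ ++ x :: p₂ ∧ x ∉ p₂ := by
  obtain ⟨r, s, hrs, hr⟩ := eq_append_cons_of_mem (mem_reverse.2 h)
  exact ⟨s.reverse, r.reverse, by simpa using congrArg reverse hrs, by simpa using hr⟩

namespace A0One

/-- The finite basis of `A₀¹`. -/
abbrev basis : Set Identity := boundedIdentities A0One 6

variable {p q r s u v : List ℕ} {x y : ℕ}

theorem derives_swap_of_mem_left (hx : x ∈ p) (hy : y ∈ p) :
    Derives basis (p ++ x :: y :: q) (p ++ y :: x :: q) :=
  FiniteBasis.derives_swap_of_mem_left le_rfl (sat_A0One_iff.2 (by decide)) hx hy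

theorem derives_swap_of_mem_right (hx : x ∈ q) (hy : y ∈ q) :
    Derives basis (p ++ x :: y :: q) (p ++ y :: x :: q) :=
  FiniteBasis.derives_swap_of_mem_right le_rfl (sat_A0One_iff.2 (by decide)) hx hy

theorem derives_delete (hp : x ∈ p) (hq : x ∈ q) : Derives basis (p ++ x :: q) (p ++ q) := by
  obtain ⟨p₁, p₂, rfl⟩ := append_of_mem hp
  obtain ⟨q₁, q₂, rfl⟩ := append_of_mem hq
  have hsat : Sat A0One [0, 1, 0, 2, 0] [0, 1, 2, 0] := sat_A0One_iff.2 (by decide)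
  have h : Derives basis _ _ := derives_flatMap hsat (by decide) (by decide)
    (by simp only [mem_cons]; tauto) fun k => [[x], p₂, q₁].getD k []
  simpa using h.context p₁ q₂

theorem derives_move_right (hx : x ∈ p) (hr : ∀ c ∈ r, c ∈ p) :
    Derives basis (p ++ x :: r ++ q) (p ++ r ++ x :: q) := by
  induction r generalizing p with
  | nil => exact Derives.of_eq (by simp)
  | cons c r ih =>
    have swap : Derives basis (p ++ x :: c :: (r ++ q)) (p ++ c :: x :: (r ++ q)) :=
      derives_swap_of_mem_left hx (hr c mem_cons_self)
    have move := ih (p := p ++ [c]) (mem_append_left _ hx)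
      fun d hd => mem_append_left _ (hr d (mem_cons_of_mem _ hd))
    simp only [append_assoc, cons_append, nil_append] at swap move ⊢
    exact swap.trans move

theorem derives_move_left (hx : x ∈ q) (hr : ∀ c ∈ r, c ∈ q) :
    Derives basis (p ++ r ++ x :: q) (p ++ x :: r ++ q) := by
  induction r generalizing p with
  | nil => exact Derives.of_eq (by simp)
  | cons c r ih =>
    have swap : Derives basis (p ++ c :: x :: (r ++ q)) (p ++ x :: c :: (r ++ q)) :=
      derives_swap_of_mem_right (mem_append_right _ (hr c mem_cons_self))
        (mem_append_right _ hx)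
    have move := ih (p := p ++ [c]) fun d hd => hr d (mem_cons_of_mem _ hd)
    simp only [append_assoc, cons_append, nil_append] at swap move ⊢
    exact move.trans swap

theorem derives_insert_of_forall_left (hp : x ∈ p) (h : ∀ c ∈ p, [c, x] <+ p) :
    Derives basis (p ++ q) (p ++ x :: q) := by
  obtain ⟨p₁, p₂, rfl, hp₂⟩ := exists_append_cons_not_mem_right hp
  have hmem : ∀ c ∈ p₁ ++ x :: p₂, c ∈ p₁ := fun c hc => by
    rcases pair_sublist_append_iff.1 (h c hc) with h | h | h
    · exact mem_left_of_pair_sublist h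
    · exact h.1
    · rcases pair_sublist_cons_iff.1 h with h | h
      · exact absurd h.2 hp₂
      · exact absurd (mem_right_of_pair_sublist h) hp₂
  have double : Derives basis (p₁ ++ x :: x :: (p₂ ++ q)) (p₁ ++ x :: (p₂ ++ q)) :=
    derives_delete (hmem x hp) mem_cons_self
  have move := derives_move_right (r := p₂) (p := p₁ ++ [x]) (q := q) (x := x) (by simp)
    fun c hc => mem_append_left _ (hmem c (by simp [hc]))
  simp only [append_assoc, cons_append, nil_append] at double move ⊢
  exact double.symm.trans move

theorem derives_insert_of_forall_right (hq : x ∈ q) (h : ∀ c ∈ q, [x, c] <+ q) :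
    Derives basis (p ++ q) (p ++ x :: q) := by
  obtain ⟨q₁, q₂, rfl, hq₁⟩ := eq_append_cons_of_mem hq
  have hmem : ∀ c ∈ q₁ ++ x :: q₂, c ∈ q₂ := fun c hc => by
    rcases pair_sublist_append_iff.1 (h c hc) with h | h | h
    · exact absurd (mem_left_of_pair_sublist h) hq₁
    · exact absurd h.1 hq₁
    · rcases pair_sublist_cons_iff.1 h with h | h
      · exact h.2
      · exact mem_right_of_pair_sublist h
  have double : Derives basis ((p ++ q₁ ++ [x]) ++ x :: q₂) ((p ++ q₁ ++ [x]) ++ q₂) :=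
    derives_delete (by simp) (hmem x hq)
  have move := derives_move_left (r := q₁) (p := p) (q := x :: q₂) (x := x) (by simp)
    fun c hc => mem_cons_of_mem _ (hmem c (by simp [hc]))
  simp only [append_assoc, cons_append, nil_append] at double move ⊢
  exact double.symm.trans move

theorem derives_insert (h : SubwordEquiv 2 (p ++ q) (p ++ x :: q)) :
    Derives basis (p ++ q) (p ++ x :: q) := by
  obtain ⟨hmem, hpair⟩ := subwordEquiv_two_iff.1 h
  by_cases hp : x ∈ p
  · by_cases hq : x ∈ q
    · exact (derives_delete hp hq).symm
    · refine derives_insert_of_forall_left hp fun c hc => ?_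
      rcases pair_sublist_append_iff.1 ((hpair c x).2
        (pair_sublist_append_iff.2 (Or.inr (Or.inl ⟨hc, mem_cons_self⟩)))) with h | h | h
      · exact h
      · exact absurd h.2 hq
      · exact absurd (mem_right_of_pair_sublist h) hq
  · have hq : x ∈ q := (mem_append.1 ((hmem x).2 (by simp))).resolve_left hp
    refine derives_insert_of_forall_right hq fun c hc => ?_
    rcases pair_sublist_append_iff.1 ((hpair x c).2 (pair_sublist_append_iff.2
      (Or.inr (Or.inr (pair_sublist_cons_iff.2 (Or.inl ⟨rfl, hc⟩)))))) with h | h | h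
    · exact absurd (mem_left_of_pair_sublist h) hp
    · exact absurd h.1 hp
    · exact h

theorem derives_of_sublist_append (hs : s <+ r) (h : SubwordEquiv 2 (p ++ s) (p ++ r)) :
    Derives basis (p ++ s) (p ++ r) := by
  induction hs generalizing p with
  | slnil => exact Derives.refl _
  | @cons s r c hs ih =>
    have hins : SubwordEquiv 2 (p ++ s) (p ++ c :: s) :=
      h.of_sublist ((sublist_cons_self c s).append_left p) ((hs.cons_cons c).append_left p)
    have hrest := ih (p := p ++ [c]) (by simpa using hins.symm.trans h)
    exact (derives_insert hins).trans (by simpa using hrest)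
  | @cons_cons _ _ c _ ih => simpa using ih (p := p ++ [c]) (by simpa using h)

theorem subwordEquiv_insert (h : SubwordEquiv 2 (p ++ s) (p ++ x :: r))
    (hx : ∀ c ∈ s, [x, c] <+ p ++ s) : SubwordEquiv 2 (p ++ s) (p ++ x :: s) := by
  rw [subwordEquiv_two_iff] at h ⊢
  have hsub : p ++ s <+ p ++ x :: s := (sublist_cons_self x s).append_left p
  refine ⟨fun c => ⟨fun hc => hsub.subset hc, fun hc => ?_⟩,
    fun c d => ⟨fun k => k.trans hsub, fun k => ?_⟩⟩
  · rcases mem_append.1 hc with hc | hc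
    · exact mem_append_left _ hc
    · rcases mem_cons.1 hc with rfl | hc
      · exact (h.1 c).2 (by simp)
      · exact mem_append_right _ hc
  · rcases pair_sublist_append_iff.1 k with k | ⟨hc, hd⟩ | k
    · exact pair_sublist_append_iff.2 (Or.inl k)
    · rcases mem_cons.1 hd with rfl | hd
      · exact (h.2 c d).2 (pair_sublist_append_iff.2 (Or.inr (Or.inl ⟨hc, mem_cons_self⟩)))
      · exact pair_sublist_append_iff.2 (Or.inr (Or.inl ⟨hc, hd⟩))
    · rcases pair_sublist_cons_iff.1 k with ⟨rfl, hd⟩ | k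
      · exact hx d hd
      · exact pair_sublist_append_iff.2 (Or.inr (Or.inr k))

theorem subwordEquiv_insert_of_mem (hx : x ∈ p) (h : SubwordEquiv 2 (p ++ s) (p ++ x :: r)) :
    SubwordEquiv 2 (p ++ s) (p ++ x :: s) :=
  subwordEquiv_insert h fun _ hc => pair_sublist_append_iff.2 (Or.inr (Or.inl ⟨hx, hc⟩))

theorem subwordEquiv_insert_of_not_mem (hxy : x ≠ y) (hx : x ∉ p)
    (h : SubwordEquiv 2 (p ++ x :: s) (p ++ y :: r)) :
    SubwordEquiv 2 (p ++ x :: s) (p ++ y :: x :: s) := by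
  refine subwordEquiv_insert h fun c hc => ?_
  obtain ⟨hmem, hpair⟩ := subwordEquiv_two_iff.1 h
  suffices hcr : c ∈ r from (hpair y c).2 (pair_sublist_append_iff.2
    (Or.inr (Or.inr (pair_sublist_cons_iff.2 (Or.inl ⟨rfl, hcr⟩)))))
  rcases mem_cons.1 hc with rfl | hcs
  · have hcv := (hmem c).1 (by simp)
    exact ((mem_cons.1 ((mem_append.1 hcv).resolve_left hx)).resolve_left hxy)
  · have hxc : [x, c] <+ p ++ y :: r := (hpair x c).1 (pair_sublist_append_iff.2
      (Or.inr (Or.inr (pair_sublist_cons_iff.2 (Or.inl ⟨rfl, hcs⟩)))))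
    rcases pair_sublist_append_iff.1 hxc with k | k | k
    · exact absurd (mem_left_of_pair_sublist k) hx
    · exact absurd k.1 hx
    · exact ((pair_sublist_cons_iff.1 k).resolve_left fun k => hxy k.1).subset (by simp)

-- If the suffixes start with distinct letters `c`, `d`, then `d` may be inserted in front of `c`
-- unless `c` occurs before, in which case `c` may be inserted in front of `d`.
theorem derives_of_subwordEquiv_append (p s r : List ℕ) (h : SubwordEquiv 2 (p ++ s) (p ++ r)) :
    Derives basis (p ++ s) (p ++ r) := by
  match s, r with
  | [], r => exact derives_of_sublist_append (nil_sublist r) h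
  | s, [] => exact (derives_of_sublist_append (nil_sublist s) h.symm).symm
  | c :: s, d :: r =>
    by_cases hcd : c = d
    · subst hcd
      simpa using derives_of_subwordEquiv_append (p ++ [c]) s r (by simpa using h)
    by_cases hc : c ∈ p
    · have hins := subwordEquiv_insert_of_mem hc h.symm
      have hrest := derives_of_subwordEquiv_append (p ++ [c]) s (d :: r)
        (by simpa using h.trans hins)
      exact Derives.trans (by simpa using hrest) (derives_insert hins).symm
    · have hins := subwordEquiv_insert_of_not_mem hcd hc h
      have hrest := derives_of_subwordEquiv_append (p ++ [d]) (c :: s) r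
        (by simpa using hins.symm.trans h)
      exact (derives_insert hins).trans (by simpa using hrest)
termination_by s.length + r.length

end A0One

theorem finitelyBased_A0One : FinitelyBased A0One :=
  finitelyBased_of_derives fun u v h =>
    A0One.derives_of_subwordEquiv_append [] u v (sat_A0One_iff.1 h)

end FiniteBasisA0One

section Blocks

/-- `w` is a block of consecutive letters of some word `a^(i+1-d) t a^d` in `W_i`. -/
def IsBlock (a t i : ℕ) (w : List ℕ) : Prop :=
  ∃ d, 0 < d ∧ d < i + 1 ∧ w <:+: replicate (i + 1 - d) a ++ t :: replicate d a

variable {a t i : ℕ} {u v w : List ℕ}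

theorem toList_of_pow (x n : ℕ) : (FreeMonoid.of x ^ n).toList = replicate n x := by
  induction n with
  | zero => rfl
  | succ n ih => rw [pow_succ, FreeMonoid.toList_mul, ih, FreeMonoid.toList_of, replicate_succ']

theorem isSubwordOf_wordSet_iff :
    IsSubwordOf (wordSet a t i) (FreeMonoid.ofList w) ↔ IsBlock a t i w := by
  have hw : ∀ d, (FreeMonoid.of a ^ (i + 1 - d) * FreeMonoid.of t * FreeMonoid.of a ^ d).toList =
      replicate (i + 1 - d) a ++ t :: replicate d a := fun d => by
    simp only [FreeMonoid.toList_mul, toList_of_pow, FreeMonoid.toList_of, append_assoc,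
      singleton_append]
  constructor
  · rintro ⟨_, ⟨d, h0, h1, rfl⟩, p, q, h⟩
    exact ⟨d, h0, h1, p.toList, q.toList, by rw [← hw, h]; rfl⟩
  · rintro ⟨d, h0, h1, p, q, h⟩
    exact ⟨_, ⟨d, h0, h1, rfl⟩, FreeMonoid.ofList p, FreeMonoid.ofList q,
      FreeMonoid.toList.injective (by rw [hw, ← h]; rfl)⟩

theorem prod_map_ofList (θ : ℕ → List ℕ) (w : List ℕ) :
    (w.map fun x => FreeMonoid.ofList (θ x)).prod = FreeMonoid.ofList (w.flatMap θ) := by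
  induction w with
  | nil => rfl
  | cons x w ih => rw [map_cons, prod_cons, ih, flatMap_cons, FreeMonoid.ofList_append]

theorem sat_SMonoid_iff : Sat (SMonoid (wordSet a t i)) u v ↔ ∀ θ : ℕ → List ℕ,
    u.flatMap θ = v.flatMap θ ∨
      (¬ IsBlock a t i (u.flatMap θ) ∧ ¬ IsBlock a t i (v.flatMap θ)) := by
  let π := (reesCon (wordSet a t i)).mk'
  have hπ : Function.Surjective fun θ : ℕ → List ℕ => fun x => π (FreeMonoid.ofList (θ x)) :=
    (Con.mk'_surjective.comp FreeMonoid.ofList.surjective).comp_left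
  have hprod : ∀ (θ : ℕ → List ℕ) (w : List ℕ),
      (w.map fun x => π (FreeMonoid.ofList (θ x))).prod = π (FreeMonoid.ofList (w.flatMap θ)) :=
    fun θ w => by rw [← prod_map_ofList, map_list_prod, map_map, Function.comp_def]
  rw [Sat, hπ.forall]
  refine forall_congr' fun θ => ?_
  rw [hprod, hprod, ← isSubwordOf_wordSet_iff, ← isSubwordOf_wordSet_iff]
  exact Con.eq _

namespace IsBlock

theorem of_infix (h : IsBlock a t i w) (hv : v <:+: w) : IsBlock a t i v :=
  let ⟨d, h0, h1, hw⟩ := h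
  ⟨d, h0, h1, hv.trans hw⟩

theorem count_le (hat : a ≠ t) (h : IsBlock a t i w) : w.count a ≤ i + 1 := by
  obtain ⟨d, -, hd, hw⟩ := h
  refine (hw.sublist.count_le a).trans ?_
  simp only [count_append, count_cons_of_ne hat.symm, count_replicate_self]
  omega

theorem count_le_one (h : IsBlock a t i w) {c : ℕ} (hc : c ≠ a) : w.count c ≤ 1 := by
  obtain ⟨d, -, -, hw⟩ := h
  refine (hw.sublist.count_le c).trans ?_
  simp only [count_append, count_cons, count_replicate, beq_eq_false_iff_ne.2 hc.symm,
    Bool.false_eq_true, if_false, zero_add]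
  split_ifs <;> omega

end IsBlock

theorem not_isBlock_replicate (hat : a ≠ t) : ¬ IsBlock a t i (replicate (i + 1) a) := by
  rintro ⟨d, h0, h1, p, q, h⟩
  have hlen := congrArg length h
  simp only [length_append, length_cons, length_replicate] at hlen
  -- Position `i + 1 - d` holds `t`, but only one letter fits outside of `a^(i+1)`.
  have ht := congrArg (·[i + 1 - d]?) h
  rw [append_assoc] at ht
  simp only [getElem?_append_right (show p.length ≤ i + 1 - d by omega), getElem?_append_left
    (show i + 1 - d - p.length < (replicate (i + 1) a).length by rw [length_replicate]; omega),
    getElem?_append_right (show (replicate (i + 1 - d) a).length ≤ i + 1 - d by simp),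
    length_replicate, Nat.sub_self, getElem?_cons_zero, getElem?_replicate] at ht
  split_ifs at ht with hlt
  · exact hat (Option.some.inj ht)

theorem isBlock_replicate {k : ℕ} (hi : 1 ≤ i) (hk : k ≤ i) : IsBlock a t i (replicate k a) :=
  ⟨1, one_pos, by omega, infix_append_of_infix_left
    ⟨replicate (i - k) a, [], by rw [append_nil, ← replicate_add, Nat.sub_add_cancel hk]; rfl⟩⟩

theorem isBlock_replicate_append_cons {k l : ℕ} (hi : 1 ≤ i) (hk : k ≤ i) (hl : l ≤ i)
    (hkl : k + l ≤ i + 1) : IsBlock a t i (replicate k a ++ t :: replicate l a) := by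
  obtain ⟨d, h0, h1, h2, h3⟩ : ∃ d, 0 < d ∧ d < i + 1 ∧ k ≤ i + 1 - d ∧ l ≤ d :=
    ⟨max l 1, by omega, by omega, by omega, by omega⟩
  refine ⟨d, h0, h1, replicate (i + 1 - d - k) a, replicate (d - l) a, ?_⟩
  rw [← append_assoc, ← replicate_add, Nat.sub_add_cancel h2, append_assoc, cons_append,
    ← replicate_add, Nat.add_sub_cancel' h3]

end Blocks

section Restrict

variable {α : Type*}

theorem cons_sublist_append_cons_iff {s : α} {l p q : List α} (hp : s ∉ p) :
    s :: l <+ p ++ s :: q ↔ l <+ q := by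
  induction p with
  | nil => exact cons_sublist_cons
  | cons c p ih =>
    rw [mem_cons, not_or] at hp
    rw [cons_append, ← ih hp.2]
    exact ⟨fun h => h.of_cons_of_ne hp.1, fun h => h.cons c⟩

theorem pair_sublist_iff_mem_right {x s : α} {p q : List α} (hp : s ∉ p) :
    [s, x] <+ p ++ s :: q ↔ x ∈ q := by
  rw [cons_sublist_append_cons_iff hp, singleton_sublist]

theorem pair_sublist_iff_mem_left {x s : α} {p q : List α} (hq : s ∉ q) :
    [x, s] <+ p ++ s :: q ↔ x ∈ p := by
  rw [← reverse_sublist, reverse_append, reverse_cons (as := q), append_assoc]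
  exact (pair_sublist_iff_mem_right (mt mem_reverse.1 hq)).trans mem_reverse

theorem triple_sublist_iff_mem_and_mem {x s : α} {p q : List α} (hp : s ∉ p) (hq : s ∉ q) :
    [x, s, x] <+ p ++ s :: q ↔ x ∈ p ∧ x ∈ q := by
  refine ⟨fun h => ⟨(pair_sublist_iff_mem_left hq).1 (.trans (by simp) h),
    (pair_sublist_iff_mem_right hp).1 (.trans (by simp) h)⟩, fun h => ?_⟩
  exact (singleton_sublist.2 h.1).append ((singleton_sublist.2 h.2).cons_cons s)

variable [DecidableEq α] {x s s' : α} {p q u v : List α}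

theorem exists_append_cons_of_count_eq_one (hs : u.count s = 1) :
    ∃ p q, u = p ++ s :: q ∧ s ∉ p ∧ s ∉ q := by
  obtain ⟨p, q, rfl, hp⟩ := eq_append_cons_of_mem (count_pos_iff.1 (hs ▸ one_pos))
  rw [count_append, count_cons_self] at hs
  exact ⟨p, q, rfl, hp, fun hq => by have := count_pos_iff.2 hq; omega⟩

/-- The word `u` with all letters except `x` and `s` deleted. -/
def restrict (x s : α) (u : List α) : List α := u.filter fun c => c = x ∨ c = s

theorem restrict_comm (x s : α) (u : List α) : restrict x s u = restrict s x u :=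
  filter_congr fun c _ => by simp only [or_comm]

theorem restrict_append (x s : α) (u v : List α) :
    restrict x s (u ++ v) = restrict x s u ++ restrict x s v := filter_append ..

theorem count_restrict_left (x s : α) (u : List α) : (restrict x s u).count x = u.count x :=
  count_filter (by simp)

theorem restrict_eq_replicate (hs : s ∉ u) : restrict x s u = replicate (u.count x) x := by
  rw [← filter_eq]
  refine filter_congr fun c hc => ?_
  simp only [show c ≠ s from fun h => hs (h ▸ hc), or_false]

theorem restrict_append_cons (hp : s ∉ p) (hq : s ∉ q) :
    restrict x s (p ++ s :: q) = replicate (p.count x) x ++ s :: replicate (q.count x) x := by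
  rw [restrict_append, restrict_eq_replicate hp, ← restrict_eq_replicate hq, restrict,
    filter_cons_of_pos (by simp), restrict]

theorem sublist_restrict_iff {l : List α} (hl : ∀ c ∈ l, c = x ∨ c = s) :
    l <+ restrict x s u ↔ l <+ u := by
  refine ⟨fun h => h.trans filter_sublist, fun h => ?_⟩
  have := h.filter fun c => decide (c = x ∨ c = s)
  rwa [filter_eq_self.2 fun c hc => decide_eq_true (hl c hc)] at this

theorem sublist_iff_of_restrict_eq (h : restrict x s u = restrict x s v) {l : List α}
    (hl : ∀ c ∈ l, c = x ∨ c = s) : l <+ u ↔ l <+ v := by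
  rw [← sublist_restrict_iff hl, h, sublist_restrict_iff hl]

theorem pair_sublist_or_of_count_eq_one (hne : s' ≠ s) (hs : u.count s = 1)
    (hs' : u.count s' = 1) : [s', s] <+ u ∨ [s, s'] <+ u := by
  obtain ⟨p, q, rfl, hp, hq⟩ := exists_append_cons_of_count_eq_one hs
  rw [pair_sublist_iff_mem_left hq, pair_sublist_iff_mem_right hp]
  have hmem : s' ∈ p ++ s :: q := count_pos_iff.1 (hs' ▸ one_pos)
  simpa [hne] using hmem

theorem restrict_eq_replicate_append (hs : u.count s = 1) (hs' : u.count s' = 1)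
    (hb : ¬ [x, s, x] <+ u) (hx : [x, s'] <+ u) (hss : [s', s] <+ u) :
    restrict x s u = replicate (u.count x) x ++ [s] := by
  obtain ⟨p, q, rfl, hp, hq⟩ := exists_append_cons_of_count_eq_one hs
  rw [pair_sublist_iff_mem_left hq] at hss
  rw [triple_sublist_iff_mem_and_mem hp hq] at hb
  have hne : s ≠ s' := fun h => hp (h ▸ hss)
  rw [count_append, count_cons_of_ne hne] at hs'
  have hs'q : s' ∉ q := fun h => by
    have := count_pos_iff.2 h
    have := count_pos_iff.2 hss
    omega
  have hxp : x ∈ p := by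
    rw [pair_sublist_append_iff, pair_sublist_cons_iff, mem_cons] at hx
    rcases hx with h | ⟨h, -⟩ | ⟨-, h⟩ | h
    · exact mem_left_of_pair_sublist h
    · exact h
    · exact absurd h hs'q
    · exact absurd (mem_right_of_pair_sublist h) hs'q
  have hxq : q.count x = 0 := count_eq_zero.2 fun h => hb ⟨hxp, h⟩
  have hsx : s ≠ x := fun h => hp (h ▸ hxp)
  rw [restrict_append_cons hp hq, count_append, count_cons_of_ne hsx, hxq, add_zero,
    replicate_zero]

theorem restrict_eq_cons_replicate (hs : u.count s = 1) (hs' : u.count s' = 1)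
    (hb : ¬ [x, s, x] <+ u) (hx : [s', x] <+ u) (hss : [s, s'] <+ u) :
    restrict x s u = s :: replicate (u.count x) x := by
  have h := restrict_eq_replicate_append (u := u.reverse) (x := x) (s := s) (s' := s')
    (by rwa [count_reverse]) (by rwa [count_reverse])
    (fun h => hb (by simpa using h.reverse)) (by simpa using hx.reverse)
    (by simpa using hss.reverse)
  rw [restrict, filter_reverse, count_reverse] at h
  rw [restrict]
  simpa using congrArg reverse h

theorem restrict_eq_of_between (hs : u.count s = 1) (hs' : u.count s' = 1)
    (huv : ∀ z, u.count z = v.count z) (hss' : restrict s s' u = restrict s s' v)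
    (hxs' : restrict x s' u = restrict x s' v) (hb : [x, s', x] <+ u)
    (hu : ¬ [x, s, x] <+ u) (hv : ¬ [x, s, x] <+ v) : restrict x s u = restrict x s v := by
  have hne : s' ≠ s := by
    rintro rfl
    exact hu hb
  have hbv : [x, s', x] <+ v := (sublist_iff_of_restrict_eq hxs' (by simp)).1 hb
  have hvs := huv s ▸ hs
  have hvs' := huv s' ▸ hs'
  rcases pair_sublist_or_of_count_eq_one hne hs hs' with h | h
  · have hv' : [s', s] <+ v := (sublist_iff_of_restrict_eq hss' (by simp)).1 h
    rw [restrict_eq_replicate_append hs hs' hu (.trans (by simp) hb) h,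
      restrict_eq_replicate_append hvs hvs' hv (.trans (by simp) hbv) hv', huv]
  · have hv' : [s, s'] <+ v := (sublist_iff_of_restrict_eq hss' (by simp)).1 h
    rw [restrict_eq_cons_replicate hs hs' hu (.trans (by simp) hb) h,
      restrict_eq_cons_replicate hvs hvs' hv (.trans (by simp) hbv) hv', huv]

theorem exists_span (hx : 2 ≤ u.count x)
    (hs : ∀ s, u.count s = 1 → ¬ [x, s, x] <+ u) :
    ∃ p w q, u = p ++ w ++ q ∧ x ∉ p ∧ x ∉ q ∧ ∀ c ∈ w, 2 ≤ u.count c := by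
  obtain ⟨p, r, rfl, hp⟩ := eq_append_cons_of_mem (count_pos_iff.1 (two_pos.trans_le hx))
  rw [count_append, count_cons_self, count_eq_zero.2 hp] at hx
  have hxr : x ∈ r := count_pos_iff.1 (by omega)
  obtain ⟨m, q, rfl, hq⟩ := exists_append_cons_not_mem_right hxr
  refine ⟨p, x :: (m ++ [x]), q, by simp, hp, hq, fun c hc => ?_⟩
  by_contra hlt
  have hmem : c ∈ p ++ x :: (m ++ x :: q) := by
    simp only [mem_append, mem_cons, not_mem_nil, or_false] at hc ⊢
    tauto
  have hc1 : (p ++ x :: (m ++ x :: q)).count c = 1 := by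
    have := count_pos_iff.2 hmem
    omega
  have hcx : c ≠ x := by
    rintro rfl
    rw [count_append, count_cons_self, count_append, count_cons_self] at hc1
    omega
  have hcm : c ∈ m := by simpa [hcx] using hc
  refine hs c hc1 ((((singleton_sublist.2 hcm).append (singleton_sublist.2 mem_cons_self)).cons_cons
    x).trans (sublist_append_right ..))

end Restrict

section Vanishing

variable {a t i : ℕ} {u v w : List ℕ} {x s : ℕ} {θ : ℕ → List ℕ}

/-- The word `u` has value `0` in `S(W_i)` under all substitutions that do not erase `x`. -/
def Vanishing (a t i x : ℕ) (u : List ℕ) : Prop :=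
  ∀ θ : ℕ → List ℕ, θ x ≠ [] → ¬ IsBlock a t i (u.flatMap θ)

theorem count_le_count_flatMap {α β : Type*} [DecidableEq α] [DecidableEq β] {θ : α → List β}
    {x : α} {c : β} (hc : c ∈ θ x) (w : List α) : w.count x ≤ (w.flatMap θ).count c := by
  induction w with
  | nil => exact zero_le
  | cons y w ih =>
    rw [flatMap_cons, count_append, count_cons]
    split_ifs with h
    · have := count_pos_iff.2 (beq_iff_eq.1 h ▸ hc)
      omega
    · omega

theorem not_isBlock_flatMap {c : ℕ} (hx : 2 ≤ u.count x) (hc : c ∈ θ x) (hca : c ≠ a) :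
    ¬ IsBlock a t i (u.flatMap θ) := fun h => by
  have := h.count_le_one hca
  have := count_le_count_flatMap hc u
  omega

theorem vanishing_of_count (hat : a ≠ t) (hx : i + 2 ≤ u.count x) : Vanishing a t i x u := by
  intro θ hθ h
  obtain ⟨c, hc⟩ := exists_mem_of_ne_nil _ hθ
  by_cases hca : c = a
  · have := h.count_le hat
    have := count_le_count_flatMap (hca ▸ hc) u
    omega
  · exact not_isBlock_flatMap (by omega) hc hca h

theorem vanishing_of_not_between (hat : a ≠ t) (hi : 1 ≤ i) (hx : i + 1 ≤ u.count x)
    (hs : ∀ s, u.count s = 1 → ¬ [x, s, x] <+ u) : Vanishing a t i x u := by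
  intro θ hθ h
  obtain ⟨p, w, q, hu, hp, hq, hw⟩ := exists_span (by omega) hs
  have hcount : u.count x = w.count x := by
    rw [hu, count_append, count_append, count_eq_zero.2 hp, count_eq_zero.2 hq, zero_add, add_zero]
  have eq_a : ∀ {c d : ℕ}, c ∈ w → d ∈ θ c → d = a := fun hc hd =>
    by_contra fun hda => not_isBlock_flatMap (hw _ hc) hd hda h
  have hwa : w.flatMap θ = replicate (w.flatMap θ).length a :=
    eq_replicate_of_mem fun d hd => let ⟨_, hc, hdc⟩ := mem_flatMap.1 hd; eq_a hc hdc
  have hlen : i + 1 ≤ (w.flatMap θ).length := by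
    obtain ⟨d, hd⟩ := exists_mem_of_ne_nil _ hθ
    exact (hx.trans (hcount ▸ count_le_count_flatMap hd w)).trans count_le_length
  refine not_isBlock_replicate hat (h.of_infix (IsInfix.trans (l₂ := w.flatMap θ) ?_
    ⟨p.flatMap θ, q.flatMap θ, by rw [hu, flatMap_append, flatMap_append]⟩))
  obtain ⟨k, hk⟩ := Nat.exists_eq_add_of_le hlen
  rw [hwa, hk, replicate_add (i + 1) k]
  exact (prefix_append _ _).isInfix

theorem Vanishing.of_infix (h : Vanishing a t i x w) (hwu : w <:+: u) : Vanishing a t i x u := by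
  obtain ⟨p, q, rfl⟩ := hwu
  refine fun θ hθ hb => h θ hθ (hb.of_infix ⟨p.flatMap θ, q.flatMap θ, ?_⟩)
  rw [flatMap_append, flatMap_append]

theorem vanishing_replicate (hat : a ≠ t) (hi : 1 ≤ i) :
    Vanishing a t i x (replicate (i + 1) x) := by
  refine vanishing_of_not_between hat hi count_replicate_self.ge fun s hs hb => ?_
  obtain rfl : s = x := eq_of_mem_replicate (hb.subset (by simp))
  rw [count_replicate_self] at hs
  omega

theorem flatMap_ite_singleton {α β : Type*} [DecidableEq α] (x : α) (b : β) (w : List α) :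
    w.flatMap (fun c => if c = x then [b] else []) = replicate (w.count x) b := by
  rw [count_eq_length_filter, ← map_const']
  induction w with
  | nil => rfl
  | cons c w ih => by_cases h : c = x <;> simp [h, ih]

theorem isBlock_flatMap_ite (hi : 1 ≤ i) (hx : u.count x ≤ i) :
    IsBlock a t i (u.flatMap fun c => if c = x then [a] else []) := by
  rw [flatMap_ite_singleton]
  exact isBlock_replicate hi hx

/-- The substitution `x ↦ a`, `s ↦ t` that erases all other letters. -/
def toBlock (a t x s c : ℕ) : List ℕ := if c = x then [a] else if c = s then [t] else []

theorem flatMap_toBlock_of_not_mem (hs : s ∉ u) :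
    u.flatMap (toBlock a t x s) = replicate (u.count x) a := by
  rw [← flatMap_ite_singleton]
  refine flatMap_congr fun c hc => ?_
  rw [toBlock, if_neg (show c ≠ s from fun h => hs (h ▸ hc))]

theorem isBlock_flatMap_toBlock (hi : 1 ≤ i) (hxs : x ≠ s) (hs : u.count s = 1)
    (hx : u.count x ≤ i ∨ (u.count x ≤ i + 1 ∧ [x, s, x] <+ u)) :
    IsBlock a t i (u.flatMap (toBlock a t x s)) := by
  obtain ⟨p, q, rfl, hp, hq⟩ := exists_append_cons_of_count_eq_one hs
  rw [triple_sublist_iff_mem_and_mem hp hq, count_append, count_cons_of_ne hxs.symm,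
    ← count_pos_iff, ← count_pos_iff] at hx
  rw [flatMap_append, flatMap_cons, flatMap_toBlock_of_not_mem hp, flatMap_toBlock_of_not_mem hq,
    toBlock, if_neg hxs.symm, if_pos rfl]
  exact isBlock_replicate_append_cons hi (by omega) (by omega) (by omega)

theorem flatMap_toBlock_flatMap (hat : a ≠ t) (u : List ℕ) :
    (u.flatMap (toBlock a t x s)).flatMap (fun c => if c = a then [x] else [s]) =
      restrict x s u := by
  conv_rhs => rw [restrict, ← flatMap_singleton' u, filter_flatMap]
  rw [flatMap_assoc]
  refine flatMap_congr fun c _ => ?_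
  by_cases hx : c = x
  · simp [toBlock, hx]
  · by_cases hs : c = s
    · subst hs
      simp [toBlock, hx, hat.symm]
    · simp [toBlock, hx, hs]

theorem vanishing_iff (hat : a ≠ t) (hi : 1 ≤ i) : Vanishing a t i x u ↔
    i + 2 ≤ u.count x ∨ (u.count x = i + 1 ∧ ∀ s, u.count s = 1 → ¬ [x, s, x] <+ u) := by
  refine ⟨fun h => ?_, fun h => h.elim (vanishing_of_count hat) fun h =>
    vanishing_of_not_between hat hi h.1.ge h.2⟩
  have hgt : i < u.count x := not_le.1 fun hx => h _ (by simp) (isBlock_flatMap_ite hi hx)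
  refine (Nat.lt_or_ge (i + 1) (u.count x)).imp id fun hle => ⟨by omega, fun s hs hb => ?_⟩
  have hxs : x ≠ s := by
    rintro rfl
    omega
  exact h (toBlock a t x s) (by simp [toBlock])
    (isBlock_flatMap_toBlock hi hxs hs (Or.inr ⟨hle, hb⟩))

theorem flatMap_eq_of_sat (h : Sat (SMonoid (wordSet a t i)) u v)
    (hb : IsBlock a t i (u.flatMap θ)) : u.flatMap θ = v.flatMap θ :=
  (sat_SMonoid_iff.1 h θ).resolve_right fun k => k.1 hb

theorem Vanishing.of_sat (h : Sat (SMonoid (wordSet a t i)) u v)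
    (hu : Vanishing a t i x u) : Vanishing a t i x v := fun θ hθ hb =>
  hu θ hθ ((sat_SMonoid_iff.1 h θ).elim (fun k => k ▸ hb) fun k => absurd hb k.2)

theorem count_eq_of_sat (h : Sat (SMonoid (wordSet a t i)) u v) (hi : 1 ≤ i)
    (hx : u.count x ≤ i) : u.count x = v.count x := by
  have := flatMap_eq_of_sat h (isBlock_flatMap_ite (a := a) (t := t) hi hx)
  simpa only [flatMap_ite_singleton, length_replicate] using congrArg length this

theorem restrict_eq_of_sat (h : Sat (SMonoid (wordSet a t i)) u v) (hat : a ≠ t)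
    (hi : 1 ≤ i) (hxs : x ≠ s) (hs : u.count s = 1)
    (hx : u.count x ≤ i ∨ (u.count x ≤ i + 1 ∧ [x, s, x] <+ u)) :
    restrict x s u = restrict x s v := by
  rw [← flatMap_toBlock_flatMap hat u, ← flatMap_toBlock_flatMap hat v,
    flatMap_eq_of_sat h (isBlock_flatMap_toBlock hi hxs hs hx)]

theorem exists_between_of_not_vanishing (hat : a ≠ t) (hi : 1 ≤ i) (hu : ¬ Vanishing a t i x u) :
    u.count x ≤ i ∨ (u.count x = i + 1 ∧ ∃ s, x ≠ s ∧ u.count s = 1 ∧ [x, s, x] <+ u) := by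
  by_cases hle : u.count x ≤ i
  · exact Or.inl hle
  rw [vanishing_iff hat hi] at hu
  push Not at hu
  have hx : u.count x = i + 1 := by omega
  obtain ⟨s, hs, hb⟩ := hu.2 hx
  refine Or.inr ⟨hx, s, ?_, hs, hb⟩
  rintro rfl
  omega

theorem count_eq_of_not_vanishing (h : Sat (SMonoid (wordSet a t i)) u v) (hat : a ≠ t)
    (hi : 1 ≤ i) (hu : ¬ Vanishing a t i x u) : u.count x = v.count x := by
  obtain hx | ⟨hx, s, hxs, hs, hb⟩ := exists_between_of_not_vanishing hat hi hu
  · exact count_eq_of_sat h hi hx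
  · rw [← count_restrict_left x s u, restrict_eq_of_sat h hat hi hxs hs (Or.inr ⟨hx.le, hb⟩),
      count_restrict_left]

theorem sat_of_vanishing (hu : Vanishing a t i x u) (hv : Vanishing a t i x v)
    (huv : u.filter (· ≠ x) = v.filter (· ≠ x)) : Sat (SMonoid (wordSet a t i)) u v := by
  refine sat_SMonoid_iff.2 fun θ => ?_
  by_cases hθ : θ x = []
  · have hfilter : ∀ c, decide (c ≠ x) = false → θ c = [] := fun c hc => by
      rw [of_not_not (of_decide_eq_false hc), hθ]
    rw [← flatMap_filter_of_forall hfilter u, huv, flatMap_filter_of_forall hfilter]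
    exact Or.inl rfl
  · exact Or.inr ⟨hu θ hθ, hv θ hθ⟩

end Vanishing

section FiniteBasisSMonoid

/-- The finite basis of `S(W_i)`. -/
abbrev basisSMonoid (a t i : ℕ) : Set Identity :=
  boundedIdentities (SMonoid (wordSet a t i)) (3 * i + 6)

variable {a t i : ℕ} {p q r u v w w' : List ℕ} {x y : ℕ}

theorem sat_swap (hx : 2 ≤ (p ++ x :: y :: q).count x) (hy : 2 ≤ (p ++ x :: y :: q).count y) :
    Sat (SMonoid (wordSet a t i)) (p ++ x :: y :: q) (p ++ y :: x :: q) := by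
  refine sat_SMonoid_iff.2 fun θ => ?_
  have hperm : p ++ x :: y :: q ~ p ++ y :: x :: q := (Perm.swap y x q).append_left p
  have vanish : ∀ {z c : ℕ}, 2 ≤ (p ++ x :: y :: q).count z → c ∈ θ z → c ≠ a →
      ¬ IsBlock a t i ((p ++ x :: y :: q).flatMap θ) ∧
        ¬ IsBlock a t i ((p ++ y :: x :: q).flatMap θ) := fun hz hc hca =>
    ⟨not_isBlock_flatMap hz hc hca, not_isBlock_flatMap (hperm.count_eq _ ▸ hz) hc hca⟩
  by_cases hxa : ∀ c ∈ θ x, c = a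
  · by_cases hya : ∀ c ∈ θ y, c = a
    · have hcomm : θ x ++ θ y = θ y ++ θ x := by
        rw [eq_replicate_of_mem hxa, eq_replicate_of_mem hya, ← replicate_add, ← replicate_add,
          add_comm]
      left
      rw [flatMap_append, flatMap_append, flatMap_cons, flatMap_cons, flatMap_cons, flatMap_cons,
        ← append_assoc (θ x), ← append_assoc (θ y), hcomm]
    · push Not at hya
      obtain ⟨c, hc, hca⟩ := hya
      exact Or.inr (vanish hy hc hca)
  · push Not at hxa
    obtain ⟨c, hc, hca⟩ := hxa
    exact Or.inr (vanish hx hc hca)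

theorem derives_swap_of_mem_of_mem (hx : x ∈ p) (hy : y ∈ q) :
    Derives (basisSMonoid a t i) (p ++ x :: y :: q) (p ++ y :: x :: q) := by
  obtain ⟨p₁, p₂, rfl⟩ := append_of_mem hx
  obtain ⟨q₁, q₂, rfl⟩ := append_of_mem hy
  have hsat : Sat (SMonoid (wordSet a t i)) [0, 2, 0, 1, 3, 1] [0, 2, 1, 0, 3, 1] :=
    sat_swap (p := [0, 2]) (by decide) (by decide)
  have h : Derives (basisSMonoid a t i) _ _ :=
    derives_flatMap hsat (.mono (M := 6) (by decide) (by omega))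
      (.mono (M := 6) (by decide) (by omega)) (fun _ => Perm.mem_iff (by decide))
      fun k => [[x], [y], p₂, q₁].getD k []
  simpa using h.context p₁ q₂

theorem derives_swap (hx : 2 ≤ (p ++ x :: y :: q).count x) (hy : 2 ≤ (p ++ x :: y :: q).count y) :
    Derives (basisSMonoid a t i) (p ++ x :: y :: q) (p ++ y :: x :: q) := by
  by_cases hxy : x = y
  · exact .of_eq (by rw [hxy])
  have mem_or : ∀ {z : ℕ}, (p ++ [x, y] ++ q).count z ≥ 2 → [x, y].count z ≤ 1 → z ∈ p ∨ z ∈ q :=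
    fun h1 h2 => by
      rw [count_append, count_append] at h1
      rw [← count_pos_iff, ← count_pos_iff]
      omega
  have hxpq : x ∈ p ∨ x ∈ q := mem_or (by simpa using hx) (by simp [Ne.symm hxy])
  have hypq : y ∈ p ∨ y ∈ q := mem_or (by simpa using hy) (by simp [hxy])
  rcases hxpq with hx | hx <;> rcases hypq with hy | hy
  · exact derives_swap_of_mem_left (by omega)
      (sat_swap (p := [0, 2, 1, 3]) (by decide) (by decide)) hx hy
  · exact derives_swap_of_mem_of_mem hx hy
  · exact (derives_swap_of_mem_of_mem hy hx).symm
  · exact derives_swap_of_mem_right (by omega) (sat_swap (p := []) (by decide) (by decide)) hx hy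

theorem derives_perm (h : w ~ w') : ∀ {p : List ℕ}, (∀ c ∈ w, 2 ≤ (p ++ w ++ q).count c) →
    Derives (basisSMonoid a t i) (p ++ w ++ q) (p ++ w' ++ q) := by
  induction h with
  | nil => exact fun _ => .refl _
  | cons c _ ih =>
    intro p hw
    simpa using ih (p := p ++ [c]) fun d hd => by simpa using hw d (mem_cons_of_mem c hd)
  | swap x y w =>
    intro p hw
    simpa using derives_swap (p := p) (q := w ++ q) (by simpa using hw y (by simp))
      (by simpa using hw x (by simp))
  | trans h₁ _ ih₁ ih₂ =>
    intro p hw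
    refine (ih₁ hw).trans (ih₂ fun c hc => ?_)
    rw [← ((h₁.append_left p).append_right q).count_eq c]
    exact hw c (h₁.mem_iff.2 hc)

/-- The word `z₀ x z₁ x z₂ ⋯ x zₘ`, where `x` is the letter `0` and `zₖ` is the letter `k + 1`:
every word with at least `m` occurrences of a letter is obtained from it by a substitution. -/
def separated : ℕ → List ℕ
  | 0 => [1]
  | m + 1 => separated m ++ [0, m + 2]

theorem length_separated (m : ℕ) : (separated m).length = 2 * m + 1 := by
  induction m with
  | zero => rfl
  | succ m ih =>
    rw [separated, length_append, ih, length_cons, length_singleton, mul_add, add_right_comm]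

theorem count_zero_separated (m : ℕ) : (separated m).count 0 = m := by
  induction m with
  | zero => rfl
  | succ m ih => rw [separated, count_append, ih]; simp

theorem lt_of_mem_separated {m c : ℕ} (hc : c ∈ separated m) : c < m + 2 := by
  induction m with
  | zero => simp_all [separated]
  | succ m ih =>
    rcases mem_append.1 hc with hc | hc
    · exact (ih hc).trans (Nat.lt_succ_self _)
    · simp only [mem_cons, not_mem_nil, or_false] at hc
      omega

theorem exists_flatMap_separated_eq {m : ℕ} (h : m ≤ u.count x) :
    ∃ θ : ℕ → List ℕ, θ 0 = [x] ∧ (separated m).flatMap θ = u := by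
  induction m generalizing u with
  | zero => exact ⟨fun c => if c = 0 then [x] else u, by simp, by simp [separated]⟩
  | succ m ih =>
    have hxu : x ∈ u := count_pos_iff.1 (m.succ_pos.trans_le h)
    obtain ⟨u₁, u₂, rfl, hx⟩ := exists_append_cons_not_mem_right hxu
    have hm : m ≤ u₁.count x := by
      rw [count_append, count_cons_self, count_eq_zero.2 hx] at h
      omega
    obtain ⟨θ, hθ, hu⟩ := ih hm
    refine ⟨Function.update θ (m + 2) u₂, by simp [hθ], ?_⟩
    have hlt : ∀ c ∈ separated m, Function.update θ (m + 2) u₂ c = θ c := fun c hc =>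
      Function.update_of_ne (lt_of_mem_separated hc).ne _ _
    rw [separated, flatMap_append, flatMap_congr hlt, hu]
    simp [hθ]

theorem flatMap_replicate_of_eq_singleton {θ : ℕ → List ℕ} (hθ : θ y = [x]) (n : ℕ) :
    (replicate n y).flatMap θ = replicate n x := by
  rw [flatMap_replicate, hθ, flatten_replicate_singleton]

theorem derives_power_comm (hat : a ≠ t) (hi : 1 ≤ i) (x : ℕ) (p : List ℕ) :
    Derives (basisSMonoid a t i) (p ++ replicate (i + 1) x) (replicate (i + 1) x ++ p) := by
  have hsat : Sat (SMonoid (wordSet a t i)) ([1] ++ replicate (i + 1) 0)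
      (replicate (i + 1) 0 ++ [1]) :=
    sat_of_vanishing ((vanishing_replicate hat hi).of_infix (suffix_append _ _).isInfix)
      ((vanishing_replicate hat hi).of_infix (prefix_append _ _).isInfix) (by simp)
  have hbounded : Bounded (3 * i + 6) ([1] ++ replicate (i + 1) 0) := by
    refine ⟨by rw [length_append, length_replicate, length_singleton]; omega, fun c hc => ?_⟩
    simp only [singleton_append, mem_cons, mem_replicate] at hc
    omega
  have hperm : [1] ++ replicate (i + 1) 0 ~ replicate (i + 1) 0 ++ [1] := perm_append_comm
  have h := derives_flatMap hsat hbounded (hbounded.perm hperm) (fun _ => hperm.mem_iff)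
    fun k => [[x], p].getD k []
  simpa [flatMap_replicate_of_eq_singleton] using h

theorem derives_power_succ (hat : a ≠ t) (hi : 1 ≤ i) (x : ℕ) :
    Derives (basisSMonoid a t i) (replicate (i + 1) x ++ [x]) (replicate (i + 1) x) := by
  have hsat : Sat (SMonoid (wordSet a t i)) (replicate (i + 1) 0 ++ [0]) (replicate (i + 1) 0) :=
    sat_of_vanishing ((vanishing_replicate hat hi).of_infix (prefix_append _ _).isInfix)
      (vanishing_replicate hat hi) (by simp)
  have h : Derives (basisSMonoid a t i) _ _ := derives_flatMap hsat
    ⟨by rw [length_append, length_replicate, length_singleton]; omega, by simp⟩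
    ⟨by rw [length_replicate]; omega, by simp⟩ (by simp) fun _ => [x]
  simpa [flatMap_replicate_of_eq_singleton] using h

theorem derives_power_filter (hat : a ≠ t) (hi : 1 ≤ i) (x : ℕ) (w : List ℕ) :
    Derives (basisSMonoid a t i) (replicate (i + 1) x ++ w)
      (replicate (i + 1) x ++ w.filter (· ≠ x)) := by
  induction w with
  | nil => exact .refl _
  | cons c w ih =>
    by_cases hc : c = x
    · subst hc
      have h := (derives_power_succ hat hi c).context [] w
      rw [nil_append, append_assoc, singleton_append, nil_append] at h
      rw [filter_cons_of_neg (by simp)]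
      exact h.trans ih
    · have move : ∀ w, Derives (basisSMonoid a t i) (c :: (replicate (i + 1) x ++ w))
          (replicate (i + 1) x ++ c :: w) := fun w => by
        simpa using (derives_power_comm hat hi x [c]).context [] w
      rw [filter_cons_of_pos (by simpa using hc)]
      exact (move w).symm.trans (((Derives.refl [c]).append ih).trans (move _))

theorem derives_collect_of_count (hat : a ≠ t) (hi : 1 ≤ i) (hx : i + 2 ≤ u.count x) :
    Derives (basisSMonoid a t i) u (replicate (i + 1) x ++ u.filter (· ≠ x)) := by
  obtain ⟨θ, hθ, rfl⟩ := exists_flatMap_separated_eq hx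
  set w := separated (i + 2)
  have hw0 : 0 ∈ w := count_pos_iff.1 (by rw [count_zero_separated]; omega)
  have hsat : Sat (SMonoid (wordSet a t i)) w (replicate (i + 1) 0 ++ w.filter (· ≠ 0)) :=
    sat_of_vanishing (vanishing_of_count hat (count_zero_separated _).ge)
      ((vanishing_replicate hat hi).of_infix (prefix_append _ _).isInfix) (by simp)
  have hw : Bounded (3 * i + 6) w :=
    ⟨by rw [length_separated]; omega, fun c hc => by have := lt_of_mem_separated hc; omega⟩
  have hmem : ∀ c, c ∈ w ↔ c ∈ replicate (i + 1) 0 ++ w.filter (· ≠ 0) := fun c => by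
    by_cases hc : c = 0 <;> simp [hc, hw0]
  have hw' : Bounded (3 * i + 6) (replicate (i + 1) 0 ++ w.filter (· ≠ 0)) := by
    refine ⟨?_, fun c hc => hw.2 c ((hmem c).2 hc)⟩
    have := length_filter_le (fun c => decide (c ≠ 0)) w
    rw [length_separated] at this
    rw [length_append, length_replicate]
    omega
  have h := derives_flatMap hsat hw hw' hmem θ
  rw [flatMap_append, flatMap_replicate_of_eq_singleton hθ] at h
  refine h.trans ((derives_power_filter hat hi x _).trans (.of_eq ?_))
  have hθ0 : ∀ c, decide (c ≠ 0) = false → (θ c).filter (· ≠ x) = [] := fun c hc => by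
    rw [of_not_not (of_decide_eq_false hc), hθ, filter_singleton]
    simp
  rw [filter_flatMap, filter_flatMap, flatMap_filter_of_forall hθ0]

theorem filter_ne_of_not_mem (hx : x ∉ u) : u.filter (· ≠ x) = u :=
  filter_eq_self.2 fun _ hc => decide_eq_true fun h => hx (h ▸ hc)

theorem replicate_append_filter_perm (x : ℕ) (u : List ℕ) :
    replicate (u.count x) x ++ u.filter (· ≠ x) ~ u := by
  rw [← filter_eq]
  simpa using filter_append_perm (fun c => decide (c = x)) u

theorem derives_collect_of_not_between (hat : a ≠ t) (hi : 1 ≤ i) (hx : u.count x = i + 1)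
    (hs : ∀ s, u.count s = 1 → ¬ [x, s, x] <+ u) :
    Derives (basisSMonoid a t i) u (replicate (i + 1) x ++ u.filter (· ≠ x)) := by
  obtain ⟨p, w, q, rfl, hp, hq, hw⟩ := exists_span (by omega) hs
  rw [count_append, count_append, count_eq_zero.2 hp, count_eq_zero.2 hq, zero_add, add_zero] at hx
  have gather : Derives (basisSMonoid a t i) (p ++ w ++ q)
      (p ++ (replicate (i + 1) x ++ w.filter (· ≠ x)) ++ q) :=
    derives_perm (hx ▸ (replicate_append_filter_perm x w).symm) hw
  have move := (derives_power_comm (a := a) (t := t) hat hi x p).context [] (w.filter (· ≠ x) ++ q)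
  rw [filter_append, filter_append, filter_ne_of_not_mem hp, filter_ne_of_not_mem hq]
  simp only [append_assoc, nil_append] at gather move ⊢
  exact gather.trans move

theorem Vanishing.derives_collect (hat : a ≠ t) (hi : 1 ≤ i) (h : Vanishing a t i x u) :
    Derives (basisSMonoid a t i) u (replicate (i + 1) x ++ u.filter (· ≠ x)) :=
  ((vanishing_iff hat hi).1 h).elim (derives_collect_of_count hat hi) fun h =>
    derives_collect_of_not_between hat hi h.1 h.2

/-- The words `u` and `v` contain each letter with the same multiplicity and in the same position
relative to the letters that occur once. -/
def SamePositions (u v : List ℕ) : Prop :=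
  (∀ x, u.count x = v.count x) ∧
    ∀ s x, x ≠ s → u.count s = 1 → restrict x s u = restrict x s v

namespace SamePositions

theorem symm (h : SamePositions u v) : SamePositions v u :=
  ⟨fun x => (h.1 x).symm, fun s x hxs hs => (h.2 s x hxs (h.1 s ▸ hs)).symm⟩

theorem trans (h : SamePositions u v) (k : SamePositions v w) : SamePositions u w :=
  ⟨fun x => (h.1 x).trans (k.1 x), fun s x hxs hs =>
    (h.2 s x hxs hs).trans (k.2 s x hxs (h.1 s ▸ hs))⟩

theorem of_perm (h : w ~ w') (hw : ∀ c ∈ w, 2 ≤ (p ++ w ++ q).count c) :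
    SamePositions (p ++ w ++ q) (p ++ w' ++ q) := by
  refine ⟨((h.append_left p).append_right q).count_eq, fun s x _ hs => ?_⟩
  have hsw : s ∉ w := fun k => by
    have := hw s k
    omega
  simp only [restrict_append, restrict_eq_replicate hsw,
    restrict_eq_replicate (mt h.mem_iff.2 hsw), h.count_eq]

/-- A letter that occurs once keeps its position relative to `y`, so `y` cannot have moved past it;
and `y` itself has moved past the letters of `r`. -/
theorem two_le_count (h : SamePositions (p ++ (r ++ y :: u)) (p ++ y :: v)) (hy : y ∉ r)
    (hr : r ≠ []) : ∀ c ∈ r ++ [y], 2 ≤ (p ++ (r ++ y :: u)).count c := by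
  have restrict_ne : ∀ c ∈ r, restrict c y (p ++ (r ++ y :: u)) ≠ restrict c y (p ++ y :: v) := by
    intro c hc heq
    have hyc : y ≠ c := fun k => hy (k ▸ hc)
    obtain ⟨n, hn⟩ := Nat.exists_eq_succ_of_ne_zero (count_pos_iff.2 hc).ne'
    rw [restrict_append _ _ p, restrict_append _ _ p, append_cancel_left_eq, restrict_append,
      restrict_eq_replicate hy, hn, replicate_succ, cons_append, restrict, restrict,
      filter_cons_of_pos (l := v) (by simp), cons.injEq] at heq
    exact hyc heq.1.symm
  intro c hc
  have hpos : 0 < (p ++ (r ++ y :: u)).count c := count_pos_iff.2 (by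
    simp only [mem_append, mem_cons, not_mem_nil, or_false] at hc ⊢
    tauto)
  by_contra hlt
  have hc1 : (p ++ (r ++ y :: u)).count c = 1 := by omega
  rcases mem_append.1 hc with hc | hc
  · have hyc : y ≠ c := fun k => hy (k ▸ hc)
    refine restrict_ne c hc ?_
    rw [restrict_comm, h.2 c y hyc hc1, restrict_comm]
  · obtain rfl := mem_singleton.1 hc
    obtain ⟨d, hd⟩ := exists_mem_of_ne_nil _ hr
    exact restrict_ne d hd (h.2 c d (fun k => hy (k ▸ hd)) hc1)

theorem derives : ∀ {p u v : List ℕ}, SamePositions (p ++ u) (p ++ v) →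
    Derives (basisSMonoid a t i) (p ++ u) (p ++ v) := by
  intro p u v h
  induction v generalizing p u with
  | nil =>
    have hu : u = [] := by simpa using (perm_iff_count.2 h.1).length_eq
    exact .of_eq (by rw [hu])
  | cons y v ih =>
    have hy : y ∈ u := (perm_append_left_iff p).1 (perm_iff_count.2 h.1) |>.mem_iff.2 mem_cons_self
    obtain ⟨r, u, rfl, hyr⟩ := eq_append_cons_of_mem hy
    by_cases hr : r = []
    · subst hr
      simpa using ih (p := p ++ [y]) (u := u) (by simpa using h)
    have hassoc : p ++ (r ++ [y]) ++ u = p ++ (r ++ y :: u) := by simp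
    have two_le : ∀ c ∈ r ++ [y], 2 ≤ (p ++ (r ++ [y]) ++ u).count c := by
      rw [hassoc]
      exact h.two_le_count hyr hr
    have hperm : r ++ [y] ~ y :: r := perm_append_singleton y r
    have move : Derives (basisSMonoid a t i) _ _ := derives_perm hperm two_le
    have rest := ih (p := p ++ [y]) (u := r ++ u) (by
      simpa using (SamePositions.of_perm hperm two_le).symm.trans (hassoc ▸ h))
    simp only [append_assoc, cons_append, nil_append] at move rest ⊢
    exact move.trans rest

end SamePositions

theorem samePositions_of_sat (hat : a ≠ t) (hi : 1 ≤ i) (h : Sat (SMonoid (wordSet a t i)) u v)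
    (hu : ∀ x, ¬ Vanishing a t i x u) : SamePositions u v := by
  have count_eq : ∀ x, u.count x = v.count x := fun x => count_eq_of_not_vanishing h hat hi (hu x)
  refine ⟨count_eq, fun s x hxs hs => ?_⟩
  obtain hx | ⟨hx, s', hxs', hs', hb⟩ := exists_between_of_not_vanishing hat hi (hu x)
  · exact restrict_eq_of_sat h hat hi hxs hs (Or.inl hx)
  by_cases hbu : [x, s, x] <+ u
  · exact restrict_eq_of_sat h hat hi hxs hs (Or.inr ⟨hx.le, hbu⟩)
  by_cases hbv : [x, s, x] <+ v
  · exact (restrict_eq_of_sat h.symm hat hi hxs (count_eq s ▸ hs)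
      (Or.inr ⟨count_eq x ▸ hx.le, hbv⟩)).symm
  have hne : s ≠ s' := by
    rintro rfl
    exact hbu hb
  exact restrict_eq_of_between hs hs' count_eq
    (restrict_eq_of_sat h hat hi hne hs' (Or.inl (hs ▸ hi)))
    (restrict_eq_of_sat h hat hi hxs' hs' (Or.inr ⟨hx.le, hb⟩)) hb hbu hbv

theorem derives_of_sat (hat : a ≠ t) (hi : 1 ≤ i) {u v : List ℕ}
    (h : Sat (SMonoid (wordSet a t i)) u v) : Derives (basisSMonoid a t i) u v := by
  by_cases hvanish : ∃ x, Vanishing a t i x u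
  · obtain ⟨x, hx⟩ := hvanish
    have hlt : (u.filter (· ≠ x)).length < u.length := by
      have hlen := (replicate_append_filter_perm x u).length_eq
      rw [length_append, length_replicate] at hlen
      have := (vanishing_iff hat hi).1 hx
      omega
    exact (hx.derives_collect hat hi).trans
      (((Derives.refl _).append (derives_of_sat hat hi (h.filter _))).trans
        ((hx.of_sat h).derives_collect hat hi).symm)
  · push Not at hvanish
    exact SamePositions.derives (p := []) (samePositions_of_sat hat hi h hvanish)
termination_by u.length
decreasing_by exact hlt

theorem finitelyBased_SMonoid (hat : a ≠ t) (hi : 1 ≤ i) :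
    FinitelyBased (SMonoid (wordSet a t i)) :=
  finitelyBased_of_derives fun _ _ => derives_of_sat hat hi

end FiniteBasisSMonoid

section TestWord

/-- The letters `y₀, y₁, …` of the test words. -/
abbrev letterY (k : ℕ) : ℕ := 2 * k + 3

/-- The letters `z₀, z₁, …` of the test words. -/
abbrev letterZ (k : ℕ) : ℕ := 2 * k + 4

/-- The word `y₀ z₀ y₁ z₁ ⋯ yₙ₋₁ zₙ₋₁`. -/
def alternating (n : ℕ) : List ℕ := (range n).flatMap fun k => [letterY k, letterZ k]

/-- The word `(z₀ ⋯ zₙ₋₁) s (xᵐ y₀ z₀ ⋯ yₙ₋₁ zₙ₋₁ x) s' (y₀ ⋯ yₙ₋₁)`, whose only linear letters are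
`s` and `s'`; the letters `x`, `s`, `s'` are encoded as `0`, `1`, `2`. -/
def testWord (m n : ℕ) : List ℕ :=
  (range n).map letterZ ++
    1 :: (replicate m 0 ++ alternating n ++ 0 :: 2 :: (range n).map letterY)

variable {j k m n c : ℕ}

theorem alternating_succ (n : ℕ) :
    alternating (n + 1) = alternating n ++ [letterY n, letterZ n] := by
  simp [alternating, range_succ]

theorem mem_alternating : c ∈ alternating n ↔ ∃ k < n, c = letterY k ∨ c = letterZ k := by
  simp [alternating]

theorem letterY_mem_alternating : letterY k ∈ alternating n ↔ k < n := by
  rw [mem_alternating]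
  exact ⟨fun ⟨l, hl, h⟩ => by simp only [letterY, letterZ] at h; omega,
    fun h => ⟨k, h, Or.inl rfl⟩⟩

theorem letterZ_mem_alternating : letterZ k ∈ alternating n ↔ k < n := by
  rw [mem_alternating]
  exact ⟨fun ⟨l, hl, h⟩ => by simp only [letterY, letterZ] at h; omega,
    fun h => ⟨k, h, Or.inr rfl⟩⟩

theorem nodup_alternating (n : ℕ) : (alternating n).Nodup := by
  induction n with
  | zero => exact nodup_nil
  | succ n ih =>
    rw [alternating_succ, nodup_append_comm, cons_append, nodup_cons, singleton_append, nodup_cons,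
      mem_cons, letterY_mem_alternating, letterZ_mem_alternating]
    exact ⟨by simp only [letterY, letterZ]; omega, lt_irrefl n, ih⟩

theorem pair_sublist_alternating_iff :
    [letterY k, letterZ j] <+ alternating n ↔ k ≤ j ∧ j < n := by
  induction n with
  | zero => simp [alternating]
  | succ n ih =>
    have hZ : letterZ j ∈ [letterY n, letterZ n] ↔ j = n := by
      simp only [mem_cons, not_mem_nil, or_false, letterY, letterZ]
      omega
    have hYZ : [letterY k, letterZ j] <+ [letterY n, letterZ n] ↔ k = n ∧ j = n := by
      simp only [pair_sublist_cons_iff, mem_cons, not_mem_nil, sublist_nil, letterY, letterZ]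
      simp
    rw [alternating_succ, pair_sublist_append_iff, ih, letterY_mem_alternating, hZ, hYZ]
    omega

theorem testWord_eq_append_two_cons (m n : ℕ) : testWord m n =
    ((range n).map letterZ ++ 1 :: (replicate m 0 ++ alternating n ++ [0])) ++
      2 :: (range n).map letterY := by
  simp [testWord]

theorem le_two_or_mem_alternating (hc : c ∈ testWord m n) : c ≤ 2 ∨ c ∈ alternating n := by
  simp only [testWord, mem_append, mem_cons, mem_map, mem_range, mem_replicate] at hc
  rcases hc with ⟨k, hk, rfl⟩ | h | (h | h) | h | h | ⟨k, hk, rfl⟩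
  · exact Or.inr (letterZ_mem_alternating.2 hk)
  · omega
  · omega
  · exact Or.inr h
  · omega
  · omega
  · exact Or.inr (letterY_mem_alternating.2 hk)

theorem one_not_mem_map_letterZ : 1 ∉ (range n).map letterZ := by
  simp [letterZ]

theorem one_not_mem_testWord_right :
    1 ∉ replicate m 0 ++ alternating n ++ 0 :: 2 :: (range n).map letterY := by
  simp only [mem_append, mem_cons, mem_map, mem_replicate, mem_alternating]
  grind

theorem two_not_mem_testWord_left :
    2 ∉ (range n).map letterZ ++ 1 :: (replicate m 0 ++ alternating n ++ [0]) := by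
  simp only [mem_append, mem_cons, mem_map, mem_replicate, mem_alternating]
  grind

theorem two_not_mem_map_letterY : 2 ∉ (range n).map letterY := by
  simp [letterY]

theorem pair_one_sublist_testWord_iff :
    [c, 1] <+ testWord m n ↔ c ∈ (range n).map letterZ :=
  pair_sublist_iff_mem_left one_not_mem_testWord_right

theorem two_pair_sublist_testWord_iff :
    [2, c] <+ testWord m n ↔ c ∈ (range n).map letterY := by
  rw [testWord_eq_append_two_cons]
  exact pair_sublist_iff_mem_right two_not_mem_testWord_left

theorem pair_sublist_testWord_iff :
    [letterY k, letterZ j] <+ testWord m n ↔ k ≤ j ∧ j < n := by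
  have hY : letterY k ∉ (range n).map letterZ ++ 1 :: replicate m 0 := by
    simp only [mem_append, mem_cons, mem_map, mem_replicate]
    grind
  have hZ : letterZ j ∉ 0 :: 2 :: (range n).map letterY := by
    simp only [mem_cons, mem_map]
    grind
  have hassoc : testWord m n = ((range n).map letterZ ++ 1 :: replicate m 0) ++
      (alternating n ++ 0 :: 2 :: (range n).map letterY) := by
    simp [testWord]
  rw [hassoc, pair_sublist_append_iff, pair_sublist_append_iff (p := alternating n),
    pair_sublist_alternating_iff]
  simp only [hY, hZ, iff_false_intro fun h => hY (mem_left_of_pair_sublist h),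
    iff_false_intro fun h => hZ (mem_right_of_pair_sublist h), false_and, and_false, false_or,
    or_false]

theorem count_zero_testWord : (testWord m n).count 0 = m + 1 := by
  have h : 0 ∉ alternating n := by
    rw [mem_alternating]
    grind
  have hZ : 0 ∉ (range n).map letterZ := by simp [letterZ]
  have hY : 0 ∉ (range n).map letterY := by simp [letterY]
  simp [testWord, count_eq_zero.2 h, count_eq_zero.2 hY, count_eq_zero.2 hZ]

theorem count_one_testWord : (testWord m n).count 1 = 1 := by
  rw [testWord, count_append, count_cons_self, count_eq_zero.2 one_not_mem_map_letterZ,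
    count_eq_zero.2 one_not_mem_testWord_right]

theorem restrict_letterZ_testWord (hk : k < n) :
    restrict (letterZ k) 1 (testWord m n) = [letterZ k, 1, letterZ k] := by
  have hleft : ((range n).map letterZ).count (letterZ k) = 1 :=
    count_eq_one_of_mem (nodup_range.map fun _ _ h => by simpa [letterZ] using h)
      (mem_map_of_mem (mem_range.2 hk))
  have hright : (replicate m 0 ++ alternating n ++ 0 :: 2 :: (range n).map letterY).count
      (letterZ k) = 1 := by
    have hY : letterZ k ∉ 0 :: 2 :: (range n).map letterY := by
      simp only [mem_cons, mem_map]
      grind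
    rw [count_append, count_append, count_eq_zero.2 hY,
      count_eq_one_of_mem (nodup_alternating n) (letterZ_mem_alternating.2 hk),
      count_eq_zero.2 (by simp [letterZ])]
  rw [testWord, restrict_append_cons one_not_mem_map_letterZ one_not_mem_testWord_right, hleft,
    hright]
  rfl

theorem restrict_letterY_testWord (hk : k < n) :
    restrict (letterY k) 2 (testWord m n) = [letterY k, 2, letterY k] := by
  have hright : ((range n).map letterY).count (letterY k) = 1 :=
    count_eq_one_of_mem (nodup_range.map fun _ _ h => by simpa [letterY] using h)
      (mem_map_of_mem (mem_range.2 hk))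
  have hleft : ((range n).map letterZ ++ 1 :: (replicate m 0 ++ alternating n ++ [0])).count
      (letterY k) = 1 := by
    have hZ : letterY k ∉ (range n).map letterZ := by
      simp only [mem_map]
      grind
    rw [count_append, count_eq_zero.2 hZ, count_cons_of_ne (by simp [letterY]), count_append,
      count_append, count_eq_one_of_mem (nodup_alternating n) (letterY_mem_alternating.2 hk),
      count_eq_zero.2 (by simp [letterY]), count_eq_zero.2 (by simp [letterY])]
  rw [testWord_eq_append_two_cons, restrict_append_cons two_not_mem_testWord_left
    two_not_mem_map_letterY, hleft, hright]
  rfl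

theorem count_letterZ_testWord (hk : k < n) : (testWord m n).count (letterZ k) = 2 := by
  rw [← count_restrict_left (letterZ k) 1, restrict_letterZ_testWord hk]
  simp [letterZ]

theorem count_letterY_testWord (hk : k < n) : (testWord m n).count (letterY k) = 2 := by
  rw [← count_restrict_left (letterY k) 2, restrict_letterY_testWord hk]
  simp [letterY]

theorem eq_of_count_testWord_eq_one (hm : m ≠ 0) (hc : (testWord m n).count c = 1) :
    c = 1 ∨ c = 2 := by
  rcases le_two_or_mem_alternating (count_pos_iff.1 (hc ▸ one_pos)) with h | h
  · have h0 : c ≠ 0 := by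
      rintro rfl
      exact hm (by rwa [count_zero_testWord, Nat.add_eq_right] at hc)
    omega
  · obtain ⟨k, hk, rfl | rfl⟩ := mem_alternating.1 h
    · rw [count_letterY_testWord hk] at hc
      omega
    · rw [count_letterZ_testWord hk] at hc
      omega

theorem vanishing_testWord {a t i : ℕ} (hat : a ≠ t) (hi : 1 ≤ i) (hm : i ≤ m) :
    Vanishing a t i 0 (testWord m n) := by
  refine vanishing_of_not_between hat hi (by rw [count_zero_testWord]; omega) fun s hs hb => ?_
  rcases eq_of_count_testWord_eq_one (by omega) hs with rfl | rfl
  · have h : [0, 1] <+ testWord m n := .trans (by simp) hb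
    simp [pair_one_sublist_testWord_iff] at h
  · have h : [2, 0] <+ testWord m n := .trans (by simp) hb
    simp [two_pair_sublist_testWord_iff] at h

theorem filter_testWord (m n : ℕ) :
    (testWord m n).filter (· ≠ 0) = (testWord 0 n).filter (· ≠ 0) := by
  simp [testWord, filter_append]

theorem sat_SMonoid_testWord {a t i : ℕ} (hat : a ≠ t) (hi : 1 ≤ i) (n : ℕ) :
    Sat (SMonoid (wordSet a t i)) (testWord i n) (testWord (i + 1) n) :=
  sat_of_vanishing (vanishing_testWord hat hi le_rfl) (vanishing_testWord hat hi (Nat.le_succ i))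
    ((filter_testWord i n).trans (filter_testWord (i + 1) n).symm)

theorem subwordEquiv_cons_cons_self {α : Type*} {p q : List α} {c : α} (hc : c ∈ q) :
    SubwordEquiv 2 (p ++ c :: q) (p ++ c :: c :: q) := by
  simp only [subwordEquiv_two_iff, mem_append, mem_cons, pair_sublist_append_iff,
    pair_sublist_cons_iff]
  grind

theorem subwordEquiv_testWord {i : ℕ} (hi : 1 ≤ i) (n : ℕ) :
    SubwordEquiv 2 (testWord i n) (testWord (i + 1) n) := by
  obtain ⟨i, rfl⟩ := Nat.exists_eq_add_of_le' hi
  have h := subwordEquiv_cons_cons_self (p := (range n).map letterZ ++ [1]) (c := 0)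
    (q := replicate i 0 ++ alternating n ++ 0 :: 2 :: (range n).map letterY) (by simp)
  simpa only [testWord, replicate_succ, append_assoc, cons_append, nil_append] using h

end TestWord

section Rigid

/-- The properties of the words `testWord m n`, with `m ≥ 1`, that survive the identities of
`A₀¹ × S(W_i)` and that make their middle part resist short identities. -/
structure Rigid (n : ℕ) (w : List ℕ) : Prop where
  count_one : w.count 1 = 1
  not_zero_one : ¬ [0, 1] <+ w
  not_one_z_z : ∀ j < n, ¬ [1, letterZ j, letterZ j] <+ w
  zero_z : ∀ j < n, [0, letterZ j] <+ w
  y_zero : ∀ k < n, [letterY k, 0] <+ w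
  y_z : ∀ k j, [letterY k, letterZ j] <+ w ↔ k ≤ j ∧ j < n

theorem rigid_of_sat {a t i n : ℕ} {w : List ℕ} (hat : a ≠ t) (hi : 1 ≤ i)
    (hs : Sat (SMonoid (wordSet a t i)) (testWord i n) w)
    (h2 : SubwordEquiv 2 (testWord i n) w) : Rigid n w := by
  have hpair := (subwordEquiv_two_iff.1 h2).2
  refine ⟨?_, ?_, fun j hj => ?_, fun j hj => ?_, fun k hk => ?_, fun k j => ?_⟩
  · rw [← count_eq_of_sat hs hi (count_one_testWord.trans_le hi), count_one_testWord]
  · rw [← hpair, pair_one_sublist_testWord_iff]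
    simp
  · have hbetween : [letterZ j, 1, letterZ j] <+ testWord i n := by
      rw [← sublist_restrict_iff (x := letterZ j) (s := 1) (by simp), restrict_letterZ_testWord hj]
    have heq := restrict_eq_of_sat hs hat hi (by simp [letterZ]) count_one_testWord
      (Or.inr ⟨(count_letterZ_testWord hj).trans_le (Nat.succ_le_succ hi), hbetween⟩)
    rw [← sublist_restrict_iff (x := letterZ j) (s := 1) (by simp), ← heq,
      restrict_letterZ_testWord hj]
    intro h
    simpa [letterZ] using h.of_cons_of_ne (by simp [letterZ])
  · rw [← hpair]
    obtain ⟨i, rfl⟩ := Nat.exists_eq_add_of_le' hi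
    simp [testWord, replicate_succ, letterZ_mem_alternating.2 hj]
  · rw [← hpair]
    simp [testWord, pair_sublist_append_iff, pair_sublist_cons_iff, letterY_mem_alternating.2 hk]
  · rw [← hpair, pair_sublist_testWord_iff]

theorem mem_right_of_pair_sublist_append {α : Type*} {x y : α} {p q : List α}
    (h : [x, y] <+ p ++ q) (hx : x ∉ p) : y ∈ q := by
  rcases pair_sublist_append_iff.1 h with h | h | h
  · exact absurd (mem_left_of_pair_sublist h) hx
  · exact h.2
  · exact mem_right_of_pair_sublist h

theorem mem_left_of_pair_sublist_append {α : Type*} {x y : α} {p q : List α}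
    (h : [x, y] <+ p ++ q) (hy : y ∉ q) : x ∈ p := by
  rcases pair_sublist_append_iff.1 h with h | h | h
  · exact mem_left_of_pair_sublist h
  · exact h.1
  · exact absurd (mem_right_of_pair_sublist h) hy

theorem pair_sublist_append {α : Type*} {x y : α} {p q : List α} (hx : x ∈ p) (hy : y ∈ q) :
    [x, y] <+ p ++ q :=
  (singleton_sublist.2 hx).append (singleton_sublist.2 hy)

namespace Rigid

variable {j k n : ℕ} {p g q : List ℕ}

theorem one_mem_left (hr : Rigid n (p ++ g ++ q)) (h0 : 0 ∈ g) (h1 : 1 ∉ g) : 1 ∈ p := by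
  have hmem : 1 ∈ p ++ g ++ q := count_pos_iff.1 (by rw [hr.count_one]; exact one_pos)
  have hq : 1 ∉ q := fun h => hr.not_zero_one (pair_sublist_append (mem_append_right p h0) h)
  simpa [h1, hq] using hmem

theorem letterZ_mem (hr : Rigid n (p ++ g ++ q)) (hp : 0 ∉ p) (hq : 0 ∉ q) (hj : j + 1 < n) :
    letterZ j ∈ g := by
  have hz : letterZ j ∈ g ++ q := by
    have h := hr.zero_z j (by omega)
    rw [append_assoc] at h
    exact mem_right_of_pair_sublist_append h hp
  have hy : letterY (j + 1) ∈ p ++ g := mem_left_of_pair_sublist_append (hr.y_zero (j + 1) hj) hq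
  refine (mem_append.1 hz).resolve_right fun h => ?_
  have := (hr.y_z (j + 1) j).1 (pair_sublist_append hy h)
  omega

theorem not_mem_right (hr : Rigid n (p ++ g ++ q)) (hp : 1 ∈ p) (hj : j < n)
    (hg : letterZ j ∈ g) : letterZ j ∉ q := fun hq => by
  refine hr.not_one_z_z j hj ?_
  rw [append_assoc]
  exact (singleton_sublist.2 hp).append (pair_sublist_append hg hq)

theorem letterY_mem (hr : Rigid n (p ++ g ++ q)) (hp : 1 ∈ p) (hjk : j < k) (hk : k < n)
    (hj : letterZ j ∈ g) (hk' : letterZ k ∈ g) : letterY k ∉ p ∧ letterY k ∈ g := by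
  have hyp : letterY k ∉ p := fun h => by
    have hyz : [letterY k, letterZ j] <+ p ++ g ++ q :=
      (pair_sublist_append h hj).trans (sublist_append_left ..)
    have := (hr.y_z k j).1 hyz
    omega
  have hy : letterY k ∈ p ++ g :=
    mem_left_of_pair_sublist_append ((hr.y_z k k).2 ⟨le_rfl, hk⟩) (hr.not_mem_right hp hk hk')
  exact ⟨hyp, (mem_append.1 hy).resolve_left hyp⟩

end Rigid

variable {α : Type*} {n : ℕ} {c d : List ℕ} {p m q u : List α} {θ : α → List ℕ}

/-- A second occurrence of `η` puts a second copy of `θ η`, which contains `yₖ` and `zₖ`, on one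
side of the first: on the left `yₖ` precedes `zⱼ`, and on the right `zₖ` is repeated. -/
theorem Rigid.le_of_letterZ_mem {η : α} {j k : ℕ}
    (hr : Rigid n (c ++ (p ++ η :: q).flatMap θ ++ d)) (h1 : 1 ∈ c ++ p.flatMap θ)
    (hη : η ∈ p ∨ η ∈ q) (hk : k < n) (hj : letterZ j ∈ θ η) (hk' : letterZ k ∈ θ η) : k ≤ j := by
  by_contra! hjk
  have hr' : Rigid n ((c ++ p.flatMap θ) ++ θ η ++ (q.flatMap θ ++ d)) := by
    simpa only [flatMap_append, flatMap_cons, append_assoc] using hr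
  obtain ⟨hyp, hy⟩ := hr'.letterY_mem h1 hjk hk hj hk'
  rcases hη with h | h
  · exact hyp (mem_append_right _ (mem_flatMap.2 ⟨η, h, hy⟩))
  · exact hr'.not_mem_right h1 hk hk' (mem_append_left _ (mem_flatMap.2 ⟨η, h, hk'⟩))

variable [DecidableEq α]

theorem Rigid.one_not_mem_flatMap (hr : Rigid n (c ++ u.flatMap θ ++ d)) {η : α}
    (hη : 2 ≤ u.count η) : 1 ∉ θ η := fun h => by
  have hw := hr.count_one
  have hu := count_le_count_flatMap h u
  rw [count_append, count_append] at hw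
  omega

theorem mem_or_mem_of_two_le_count {η : α} (h : 2 ≤ (p ++ η :: q).count η) : η ∈ p ∨ η ∈ q := by
  rw [count_append, count_cons_self] at h
  rw [← count_pos_iff, ← count_pos_iff]
  omega

theorem Rigid.eq_of_letterZ_mem {η : α} {j k : ℕ}
    (hr : Rigid n (c ++ (p ++ m ++ q).flatMap θ ++ d)) (h1 : 1 ∈ c ++ p.flatMap θ) (hη : η ∈ m)
    (hcount : 2 ≤ (p ++ m ++ q).count η) (hj : j < n) (hk : k < n) (hzj : letterZ j ∈ θ η)
    (hzk : letterZ k ∈ θ η) : j = k := by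
  obtain ⟨m₁, m₂, rfl⟩ := append_of_mem hη
  have hsplit : p ++ (m₁ ++ η :: m₂) ++ q = (p ++ m₁) ++ η :: (m₂ ++ q) := by simp
  rw [hsplit] at hr hcount
  have h1' : 1 ∈ c ++ (p ++ m₁).flatMap θ := by
    rw [flatMap_append, ← append_assoc]
    exact mem_append_left _ h1
  have hmem := mem_or_mem_of_two_le_count hcount
  exact le_antisymm (hr.le_of_letterZ_mem h1' hmem hj hzk hzj)
    (hr.le_of_letterZ_mem h1' hmem hk hzj hzk)

/-- The letters `z₀, …, zₙ₋₂` all lie in `m.flatMap θ`, and no letter of `m` covers two of them. -/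
theorem Rigid.le_length_add_one (hr : Rigid n (c ++ (p ++ m ++ q).flatMap θ ++ d))
    (hm : ∀ η ∈ m, 2 ≤ (p ++ m ++ q).count η) (h0 : 0 ∈ m.flatMap θ)
    (hp : 0 ∉ c ++ p.flatMap θ) (hq : 0 ∉ q.flatMap θ ++ d) : n ≤ m.length + 1 := by
  have hr' : Rigid n ((c ++ p.flatMap θ) ++ m.flatMap θ ++ (q.flatMap θ ++ d)) := by
    simpa only [flatMap_append, append_assoc] using hr
  have h1 : 1 ∈ c ++ p.flatMap θ := hr'.one_mem_left h0 fun h =>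
    let ⟨_, hη, h1η⟩ := mem_flatMap.1 h; hr.one_not_mem_flatMap (hm _ hη) h1η
  have hcover : ∀ j : Fin (n - 1), ∃ η ∈ m, letterZ j ∈ θ η := fun j =>
    mem_flatMap.1 (hr'.letterZ_mem hp hq (by omega))
  choose f hfm hf using hcover
  have hinj : Function.Injective f := fun j k hjk =>
    Fin.ext (hr.eq_of_letterZ_mem h1 (hfm j) (hm _ (hfm j)) (by omega) (by omega) (hf j)
      (hjk ▸ hf k))
  have hcard : n - 1 ≤ m.toFinset.card := by
    simpa using Finset.card_le_card_of_injOn (s := Finset.univ) f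
      (fun j _ => mem_toFinset.2 (hfm j)) hinj.injOn
  have := toFinset_card_le m
  omega

end Rigid

section NotFinitelyBased

/-- The syntactic congruence of the set of words `P`: two words are related if they can replace each
other in any context without affecting membership in `P`. -/
def syntacticCon (P : List ℕ → Prop) : Con (FreeSemigroup ℕ) where
  r p q := ∀ c d, P (c ++ toWord p ++ d) ↔ P (c ++ toWord q ++ d)
  iseqv := ⟨fun _ _ _ => Iff.rfl, fun h c d => (h c d).symm,
    fun h k c d => (h c d).trans (k c d)⟩
  mul' {p q p' q'} h h' c d := by
    have hp := h c (toWord p' ++ d)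
    have hq := h' (c ++ toWord q) d
    simp only [toWord_mul, append_assoc] at hp hq ⊢
    exact hp.trans hq

/-- A set of words that is closed under the consequences of the identities of `S` whose left-hand
side is short. -/
def Closed (S : Type*) [Monoid S] (N : ℕ) (P : List ℕ → Prop) : Prop :=
  ∀ α β : List ℕ, Sat S α β → α.length ≤ N → ∀ (θ : ℕ → List ℕ) (c d : List ℕ),
    P (c ++ α.flatMap θ ++ d) → P (c ++ β.flatMap θ ++ d)

theorem not_finitelyBased_of_closed {S : Type*} [Monoid S]
    (h : ∀ N, ∃ (P : List ℕ → Prop) (u v : List ℕ), Closed S N P ∧ u ≠ [] ∧ v ≠ [] ∧ Sat S u v ∧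
      P u ∧ ¬ P v) : ¬ FinitelyBased S := by
  rintro ⟨E, hE, hsat, hded⟩
  obtain ⟨N, hN⟩ := (hE.image fun e : Identity =>
    max (toWord e.1).length (toWord e.2).length).bddAbove
  obtain ⟨P, u, v, hP, hu, hv, huv, hPu, hPv⟩ := h N
  obtain ⟨p, rfl⟩ := exists_toWord_eq hu
  obtain ⟨q, rfl⟩ := exists_toWord_eq hv
  have hle : conGen (fun p q : FreeSemigroup ℕ => ∃ f ∈ E,
      ∃ Θ : FreeSemigroup ℕ →ₙ* FreeSemigroup ℕ, p = Θ f.1 ∧ q = Θ f.2) ≤ syntacticCon P := by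
    refine Con.conGen_le.2 ?_
    rintro _ _ ⟨f, hf, Θ, rfl, rfl⟩ c d
    have hfS := (satisfies_iff f).1 (hsat f hf)
    have hfN := max_le_iff.1 (hN ⟨f, hf, rfl⟩)
    rw [toWord_map, toWord_map]
    exact ⟨hP _ _ hfS hfN.1 _ c d, hP _ _ hfS.symm hfN.2 _ c d⟩
  have hpq := hle (hded (p, q) ((satisfies_iff (p, q)).2 huv)) [] []
  simp only [nil_append, append_nil] at hpq
  exact hPv (hpq.1 hPu)

variable {a t i n : ℕ} {c d u w : List ℕ} {θ : ℕ → List ℕ}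

theorem count_flatMap_congr {α β : Type*} [DecidableEq α] [DecidableEq β] {θ : α → List β}
    {x : β} {u v : List α} (h : ∀ ξ, x ∈ θ ξ → u.count ξ = v.count ξ) :
    (u.flatMap θ).count x = (v.flatMap θ).count x := by
  have filter_flatMap_eq : ∀ w : List α, (w.flatMap θ).filter (· == x) =
      (w.filter (x ∈ θ ·)).flatMap fun ξ => (θ ξ).filter (· == x) := fun w => by
    rw [filter_flatMap, flatMap_filter_of_forall]
    intro ξ hξ
    exact filter_eq_nil_iff.2 fun c hc hcx => of_decide_eq_false hξ (beq_iff_eq.1 hcx ▸ hc)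
  have hperm : u.filter (x ∈ θ ·) ~ v.filter (x ∈ θ ·) := perm_iff_count.2 fun ξ => by
    by_cases hξ : x ∈ θ ξ
    · rw [count_filter (by simpa), count_filter (by simpa), h ξ hξ]
    · rw [count_eq_zero.2 (by simp [hξ]), count_eq_zero.2 (by simp [hξ])]
  rw [count_eq_length_filter, count_eq_length_filter, filter_flatMap_eq, filter_flatMap_eq]
  exact (hperm.flatMap_right _).length_eq

/-- The words equivalent to `testWord i n` over `A₀¹ × S(W_i)` that contain `0` as many times as
`testWord i n` does. -/
def Reachable (a t i n : ℕ) (w : List ℕ) : Prop :=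
  Sat (A0One × SMonoid (wordSet a t i)) (testWord i n) w ∧ w.count 0 = i + 1

theorem Reachable.rigid (hw : Reachable a t i n w) (hat : a ≠ t) (hi : 1 ≤ i) : Rigid n w :=
  let h := sat_prod_iff.1 hw.1
  rigid_of_sat hat hi h.2 (sat_A0One_iff.1 h.1)

theorem le_length_add_one_of_vanishing (hw : Reachable a t i n (c ++ u.flatMap θ ++ d))
    (hat : a ≠ t) (hi : 1 ≤ i) {ξ : ℕ} (hξ : 0 ∈ θ ξ) (hu : Vanishing a t i ξ u) :
    n ≤ u.length + 1 := by
  have hw0 := hw.2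
  have hle := count_le_count_flatMap hξ u
  rw [count_append, count_append] at hw0
  obtain ⟨hcount, hs⟩ := ((vanishing_iff hat hi).1 hu).resolve_left (by omega)
  obtain ⟨p, m, q, rfl, hp, hq, hm⟩ := exists_span (by omega) hs
  have hlem := count_le_count_flatMap hξ m
  rw [flatMap_append, flatMap_append, count_append, count_append] at hw0
  rw [count_append, count_append, count_eq_zero.2 hp, count_eq_zero.2 hq] at hcount
  have hlen := (hw.rigid hat hi).le_length_add_one hm
    (count_pos_iff.1 (by omega))
    (by rw [← count_eq_zero, count_append]; omega)
    (by rw [← count_eq_zero, count_append]; omega)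
  rw [length_append, length_append]
  omega

theorem closed_reachable (hat : a ≠ t) (hi : 1 ≤ i) (n : ℕ) :
    Closed (A0One × SMonoid (wordSet a t i)) n (Reachable a t i (n + 2)) := by
  intro α β hαβ hlen θ c d hw
  refine ⟨hw.1.trans ((hαβ.subst θ).context c d), ?_⟩
  suffices h : (α.flatMap θ).count 0 = (β.flatMap θ).count 0 by
    simpa only [count_append, h] using hw.2
  refine count_flatMap_congr fun ξ hξ =>
    count_eq_of_not_vanishing (sat_prod_iff.1 hαβ).2 hat hi fun hvan => ?_
  have := le_length_add_one_of_vanishing hw hat hi hξ hvan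
  omega

theorem not_finitelyBased_prod (hat : a ≠ t) (hi : 1 ≤ i) :
    ¬ FinitelyBased (A0One × SMonoid (wordSet a t i)) := by
  have ne_nil : ∀ m n, testWord m n ≠ [] := by simp [testWord]
  refine not_finitelyBased_of_closed fun N => ⟨Reachable a t i (N + 2), testWord i (N + 2),
    testWord (i + 1) (N + 2), closed_reachable hat hi N, ne_nil _ _, ne_nil _ _, ?_,
    ⟨Sat.refl _, count_zero_testWord⟩, fun h => ?_⟩
  · exact sat_prod_iff.2
      ⟨sat_A0One_iff.2 (subwordEquiv_testWord hi _), sat_SMonoid_testWord hat hi _⟩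
  · have := h.2
    rw [count_zero_testWord] at this
    omega

end NotFinitelyBased

end FiniteBasis

theorem mainTheorem9 (a t : FiniteBasis.Alphabet) (hat : a ≠ t) :
    FiniteBasis.FinitelyBased FiniteBasis.A0One ∧
      ∀ i : ℕ, 1 ≤ i →
        FiniteBasis.FinitelyBased (FiniteBasis.SMonoid (FiniteBasis.wordSet a t i)) ∧
        ¬ FiniteBasis.FinitelyBased
          (FiniteBasis.A0One × FiniteBasis.SMonoid (FiniteBasis.wordSet a t i)) :=
  ⟨FiniteBasis.finitelyBased_A0One, fun _ hi =>
    ⟨FiniteBasis.finitelyBased_SMonoid hat hi, FiniteBasis.not_finitelyBased_prod hat hi⟩⟩
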